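/- Let $(g_k)_{k\in\mathbb Z}$ be complex numbers. For a sequence $(\mu_k)_{k\ge 0}$ put $\Delta\mu_k=\mu_{k+1}-\mu_k$ and $w_k^{(n)}\{\mu\}=\binom nk(-1)^{n-k}\Delta^{n-k}\mu_k$ $(0\le k\le n)$. Assume that each of the two sequences $\mu_k=k\,g_k$ and $\mu_k=k\,g_{-k}$ $(k=0,1,2,\dots)$ satisfies, for some constant $M>0$, $$(n+1)\sum_{k=0}^n\bigl|w_k^{(n)}\{\mu\}\bigr|^2<M\qquad(n=0,1,2,\dots).$$ Let $\Xi_\pm=\{2k\pi\pm iv:\ k\in\mathbb Z,\ v>0\}$ and consider $$\mathcal G^{(+)}(\tau)=\frac1{2\pi}\sum_{k=1}^\infty g_k e^{-ik\tau},\qquad \mathcal G^{(-)}(\tau)=\frac1{2\pi}\sum_{k=1}^\infty g_{-k}e^{ik\tau}.$$ The first series converges for $\operatorname{Im}\tau\le 0$, the second for $\operatorname{Im}\tau\ge 0$, and: (i) $u\mapsto\mathcal G^{(\pm)}(u)$ $(u\in\mathbb R)$ are continuous. (ii) $\mathcal G^{(\pm)}$ is holomorphic in the half-plane $\mp\operatorname{Im}\tau>0$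 and extends to a function (again denoted $\mathcal G^{(\pm)}$) that is holomorphic on $\mathbb C\setminus\overline{\Xi_\pm}$ and continuous on $\mathbb C\setminus\Xi_\pm$. (iii) For every $v\ge 0$ the limit $$J^{(+)}(v)=i\lim_{\varepsilon\downarrow0}\bigl[\mathcal G^{(+)}(2k\pi+\varepsilon+iv)-\mathcal G^{(+)}(2k\pi-\varepsilon+iv)\bigr]$$ exists and does not depend on $k\in\mathbb Z$; $J^{(+)}$ is continuous on $[0,\infty)$, $J^{(+)}(v)=o(e^{v/2})$ as $v\to+\infty$, and $J^{(+)}(0)=0$. For every $v\le 0$ the limit $$J^{(-)}(v)=-i\lim_{\varepsilon\downarrow0}\bigl[\mathcal G^{(-)}(2k\pi+\varepsilon+iv)-\mathcal G^{(-)}(2k\pi-\varepsilon+iv)\bigr]$$ exists and does not depend on $k\in\mathbb Z$; $J^{(-)}$ is continuous on $(-\infty,0]$, $J^{(-)}(v)=o(e^{-v/2})$ as $v\to-\infty$, and $J^{(-)}(0)=0$. (iv) The function $\mathcal G=\mathcal G^{(+)}+\mathcal G^{(-)}+g_0/2\pi$ on $\mathbb C\setminus(\Xi_+\cup\Xi_-)$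 is periodic with period $2\pi$. For every $k\in\mathbb Z$ it is holomorphic in the open strip $2k\pi<\operatorname{Re}\tau<2(k+1)\pi$, and continuous up to the boundary: there is a continuous function on the closed strip that agrees with $\mathcal G$ on the closed strip minus $\Xi_+\cup\Xi_-$. (v) The Laplace transforms $$\widetilde J^{(+)}(\lambda)=\int_0^\infty J^{(+)}(v)e^{-\lambda v}\,dv,\qquad \widetilde J^{(-)}(\lambda)=\int_{-\infty}^0J^{(-)}(v)e^{\lambda v}\,dv$$ converge absolutely and are analytic in the half-plane $\operatorname{Re}\lambda>\tfrac12$. (vi) $g_k=\widetilde J^{(+)}(k)$ and $g_{-k}=\widetilde J^{(-)}(k)$ for $k=1,2,3,\dots$. -/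

import Mathlib

open Filter Topology Set Complex Asymptotics MeasureTheory

noncomputable section

namespace KMSBoson

/-- The Bernstein weights `w_k^{(n)}{μ} = C(n,k) (-1)^{n-k} Δ^{n-k} μ_k` of a sequence `μ`,
where `Δ μ_k = μ_{k+1} - μ_k`. -/
def bernsteinWeight (μ : ℕ → ℂ) (n k : ℕ) : ℂ :=
  (n.choose k : ℂ) * (-1) ^ (n - k) * ((fwdDiff 1)^[n - k] μ) k

/-- Hausdorff's condition with exponent `p`:
`(n+1)^{p-1} ∑_{k=0}^n |w_k^{(n)}{μ}|^p < M` for all `n`, with some constant `M > 0`. -/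
def HausdorffCondition (p : ℝ) (μ : ℕ → ℂ) : Prop :=
  ∃ M : ℝ, 0 < M ∧ ∀ n : ℕ,
    ((n : ℝ) + 1) ^ (p - 1) * ∑ k ∈ Finset.range (n + 1), ‖bernsteinWeight μ n k‖ ^ p < M

/-- The cuts `{2kπ + iv : v > 0, k ∈ ℤ}` in the upper half-plane. -/
def cutPlus : Set ℂ := {τ | ∃ (k : ℤ) (v : ℝ), 0 < v ∧ τ = 2 * k * Real.pi + v * I}

/-- The cuts `{2kπ - iv : v > 0, k ∈ ℤ}` in the lower half-plane. -/
def cutMinus : Set ℂ := {τ | ∃ (k : ℤ) (v : ℝ), 0 < v ∧ τ = 2 * k * Real.pi - v * I}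

/-- The open strip `2kπ < Re τ < 2(k+1)π`. -/
def openStrip (k : ℤ) : Set ℂ :=
  {τ | 2 * k * Real.pi < τ.re ∧ τ.re < 2 * (k + 1) * Real.pi}

/-- The closed strip `2kπ ≤ Re τ ≤ 2(k+1)π`. -/
def closedStrip (k : ℤ) : Set ℂ :=
  {τ | 2 * k * Real.pi ≤ τ.re ∧ τ.re ≤ 2 * (k + 1) * Real.pi}

/-- `G` sums the series `(1/2π) ∑_{k ≥ 1} g_k e^{-ikτ}` at every point of the closed lower
half-plane (the summation index is `n = k - 1`). -/
def SumsPlus (g : ℤ → ℂ) (G : ℂ → ℂ) : Prop :=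
  ∀ τ : ℂ, τ.im ≤ 0 →
    HasSum (fun n : ℕ => 1 / (2 * Real.pi) * (g (n + 1) * cexp (-I * (n + 1) * τ))) (G τ)

/-- `G` sums the series `(1/2π) ∑_{k ≥ 1} g_{-k} e^{ikτ}` at every point of the closed upper
half-plane. -/
def SumsMinus (g : ℤ → ℂ) (G : ℂ → ℂ) : Prop :=
  ∀ τ : ℂ, 0 ≤ τ.im →
    HasSum (fun n : ℕ => 1 / (2 * Real.pi) * (g (-(n + 1)) * cexp (I * (n + 1) * τ))) (G τ)

/-- `J` is the jump of `i G` across each of the cuts `{2kπ + iv : v > 0}` (with the same limit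
taken at the end point `v = 0`). -/
def IsJumpPlus (G : ℂ → ℂ) (J : ℝ → ℂ) : Prop :=
  ∀ (k : ℤ) (v : ℝ), 0 ≤ v →
    Tendsto (fun ε : ℝ => I * (G (2 * k * Real.pi + ε + v * I) - G (2 * k * Real.pi - ε + v * I)))
      (𝓝[>] 0) (𝓝 (J v))

/-- `J` is the jump of `-i G` across each of the cuts `{2kπ + iv : v < 0}` (with the same limit
taken at the end point `v = 0`). -/
def IsJumpMinus (G : ℂ → ℂ) (J : ℝ → ℂ) : Prop :=
  ∀ (k : ℤ) (v : ℝ), v ≤ 0 →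
    Tendsto (fun ε : ℝ => -I * (G (2 * k * Real.pi + ε + v * I) - G (2 * k * Real.pi - ε + v * I)))
      (𝓝[>] 0) (𝓝 (J v))

/-- `∫_0^∞ J(v) e^{-s v} dv`. -/
def laplacePlus (J : ℝ → ℂ) (s : ℂ) : ℂ := ∫ v in Ioi (0 : ℝ), J v * cexp (-s * v)

/-- `∫_{-∞}^0 J(v) e^{s v} dv`. -/
def laplaceMinus (J : ℝ → ℂ) (s : ℂ) : ℂ := ∫ v in Iio (0 : ℝ), J v * cexp (s * v)

end KMSBoson

end

noncomputable section

namespace KMSBoson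

open scoped Polynomial ComplexConjugate

/-! Each Hausdorff condition makes its sequence the moment sequence of a density `f ∈ L²(0,1]`: `k
g_k = ∫ x^k f(x) dx`. Dividing by `k` and summing under the integral gives `∑ g_k z^k = -∫ f(x)
log(1 - xz) dx`, to be used at `z = e^{-iτ}`, and all the claims are read off this formula. The
integral is holomorphic off `[1, ∞)`, whose preimage under `τ ↦ e^{-iτ}` is the closure of the cuts.
At `z = e^v` the logarithm jumps by `2πi` for exactly those `x` with `x > e^{-v}`, so the jump
function is `J(v) = ∫_{e^{-v}}^1 f`, which is continuous, bounded and zero at `0`. By Fubini its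
Laplace transform is `(1/s) ∫ x^s f(x) dx`, which equals `g_k` at `s = k`.

Two points need work. The density (`exists_density_of_hausdorffCondition`) is a weak limit of the
polynomials `(n+1) ∑ w_k b_{n,k}`: Jensen turns the hypothesis into an `L²` bound, and their moments
converge to `μ`. Continuity up to the cuts and at the branch points (`continuousOn_logTransform`)
holds because cutting the logarithm off at `-m` changes the integral by `O(e^{-m/4})` uniformly in
`z`; this rests on `f ∈ L²` and on a bound for `∫ ‖1 - xz‖^{-1/2} dx` independent of `z`.

The second series is the first one, built from the other density, under `τ ↦ -τ`. -/

/-! ### Bernstein weights and the moment functional -/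

/-- The linear functional on polynomials with moments `μ`. -/
def momentFunctional (μ : ℕ → ℂ) : ℂ[X] →ₗ[ℂ] ℂ :=
  Polynomial.lsum fun k => LinearMap.mulRight ℂ (μ k)

lemma momentFunctional_X_pow (μ : ℕ → ℂ) (k : ℕ) :
    momentFunctional μ (Polynomial.X ^ k) = μ k := by
  simp [momentFunctional, Polynomial.lsum_apply, ← Polynomial.monomial_one_right_eq_X_pow,
    Polynomial.sum_monomial_index]

/-- Multiplying a polynomial by `1 - X` acts on moments as `-Δ`. -/
lemma momentFunctional_X_pow_mul (μ : ℕ → ℂ) (m k : ℕ) :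
    momentFunctional μ (Polynomial.X ^ k * (1 - Polynomial.X) ^ m)
      = (-1) ^ m * ((fwdDiff 1)^[m] μ) k := by
  induction m generalizing k with
  | zero => simp [momentFunctional_X_pow]
  | succ m ih =>
    have : (Polynomial.X ^ k * (1 - Polynomial.X) ^ (m + 1) : ℂ[X])
      = Polynomial.X ^ k * (1 - Polynomial.X) ^ m
        - Polynomial.X ^ (k + 1) * (1 - Polynomial.X) ^ m := by ring
    rw [this, map_sub, ih, ih, Function.iterate_succ_apply', fwdDiff]
    ring

lemma momentFunctional_bernstein (μ : ℕ → ℂ) (n k : ℕ) :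
    momentFunctional μ (bernsteinPolynomial ℂ n k) = bernsteinWeight μ n k := by
  have : bernsteinPolynomial ℂ n k
      = (n.choose k : ℂ) • (Polynomial.X ^ k * (1 - Polynomial.X) ^ (n - k)) := by
    rw [bernsteinPolynomial, Polynomial.smul_eq_C_mul]
    simp [mul_assoc]
  rw [this, map_smul, momentFunctional_X_pow_mul, bernsteinWeight, smul_eq_mul, mul_assoc]

/-- These are the factorial moments of the binomial distribution: `C(n,k) C(k,i) = C(n,i)
C(n-i,k-i)`, and what remains is a binomial expansion of `(X + (1 - X))^(n-i)`. Under
`momentFunctional` the identity recovers `μ i` from the weights. -/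
lemma sum_choose_mul_bernstein (n i : ℕ) :
    ∑ k ∈ Finset.range (n + 1), (k.choose i : ℂ) • bernsteinPolynomial ℂ n k
      = (n.choose i : ℂ) • Polynomial.X ^ i := by
  rcases le_or_gt i n with h | h
  · obtain ⟨m, rfl⟩ := Nat.exists_eq_add_of_le h
    have key : ∀ k ∈ Finset.range (m + 1),
        ((i + k).choose i : ℂ) • bernsteinPolynomial ℂ (i + m) (i + k)
          = (((i + m).choose i : ℂ) • Polynomial.X ^ i) *
            (Polynomial.X ^ k * (1 - Polynomial.X) ^ (m - k) * ((m.choose k : ℕ) : ℂ[X])) := by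
      intro k _
      have := Nat.choose_mul (n := i + m) (k := i + k) (s := i) (Nat.le_add_right i k)
      simp only [Nat.add_sub_cancel_left] at this
      have h2 : ((i + m).choose (i + k) : ℂ[X]) * ((i + k).choose i : ℂ[X])
        = ((i + m).choose i : ℂ[X]) * (m.choose k : ℂ[X]) := by exact_mod_cast this
      rw [bernsteinPolynomial, Polynomial.smul_eq_C_mul, Polynomial.smul_eq_C_mul,
        Nat.add_sub_add_left]
      simp only [map_natCast]
      linear_combination Polynomial.X ^ (i + k) * (1 - Polynomial.X) ^ (m - k) * h2
    rw [add_assoc, Finset.sum_range_add, Finset.sum_eq_zero, zero_add, Finset.sum_congr rfl key,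
      ← Finset.mul_sum, ← add_pow]
    · simp
    · intro k hk
      simp [Nat.choose_eq_zero_of_lt (Finset.mem_range.mp hk)]
  · rw [Nat.choose_eq_zero_of_lt h, Finset.sum_eq_zero]
    · simp
    · intro k hk
      rw [Nat.choose_eq_zero_of_lt (by have := Finset.mem_range.mp hk; omega)]
      simp

lemma sum_choose_mul_bernsteinWeight (μ : ℕ → ℂ) (n i : ℕ) :
    ∑ k ∈ Finset.range (n + 1), (k.choose i : ℂ) * bernsteinWeight μ n k
      = (n.choose i : ℂ) * μ i := by
  have := congrArg (momentFunctional μ) (sum_choose_mul_bernstein n i)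
  simpa [map_sum, momentFunctional_bernstein, momentFunctional_X_pow] using this

/-! ### Moments and `L²` bound of the Bernstein densities -/

lemma integral_pow_mul_one_sub_pow (a b : ℕ) :
    ∫ x in (0 : ℝ)..1, (x : ℂ) ^ a * (1 - x : ℂ) ^ b
      = (a.factorial : ℂ) * b.factorial / (a + b + 1).factorial := by
  have h := Complex.Gamma_mul_Gamma_eq_betaIntegral (s := a + 1) (t := b + 1)
    (by simp; positivity) (by simp; positivity)
  have e : ((a : ℂ) + 1 + (b + 1)) = ((a + b + 1 : ℕ) : ℂ) + 1 := by push_cast; ring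
  rw [e, Complex.Gamma_nat_eq_factorial, Complex.Gamma_nat_eq_factorial,
    Complex.Gamma_nat_eq_factorial, Complex.betaIntegral] at h
  simp only [add_sub_cancel_right, Complex.cpow_natCast] at h
  rw [h]
  field_simp [Nat.cast_ne_zero.mpr (Nat.factorial_ne_zero (a + b + 1))]

/-- Beta integral. The value is written with `(k + j).choose j` because Vandermonde expands that in
the `k.choose i`, whose weighted sums are known. -/
lemma integral_pow_mul_bernstein {n k : ℕ} (hk : k ≤ n) (j : ℕ) :
    ((n : ℂ) + 1) * ∫ x in (0 : ℝ)..1, (x : ℂ) ^ j * (bernsteinPolynomial ℂ n k).eval (x : ℂ)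
      = (k + j).choose j / (n + 1 + j).choose j := by
  have e : ∀ x : ℝ, (x : ℂ) ^ j * (bernsteinPolynomial ℂ n k).eval (x : ℂ)
      = (n.choose k : ℂ) * ((x : ℂ) ^ (k + j) * (1 - x : ℂ) ^ (n - k)) := by
    intro x
    simp [bernsteinPolynomial]
    ring
  simp only [e, intervalIntegral.integral_const_mul, integral_pow_mul_one_sub_pow]
  have h1 : (k + j) + (n - k) + 1 = n + 1 + j := by omega
  rw [h1, Nat.cast_choose ℂ hk, Nat.cast_choose ℂ (Nat.le_add_left j k),
    Nat.cast_choose ℂ (Nat.le_add_left j (n + 1)), Nat.add_sub_cancel, Nat.add_sub_cancel,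
    Nat.factorial_succ n]
  have hf : ∀ m : ℕ, ((m.factorial : ℕ) : ℂ) ≠ 0 := fun m =>
    Nat.cast_ne_zero.mpr (Nat.factorial_ne_zero m)
  have := hf j; have := hf k; have := hf (n - k); have := hf (n + 1 + j); have := hf (k + j)
  have := hf n
  push_cast
  have : (n : ℂ) + 1 ≠ 0 := by exact_mod_cast Nat.succ_ne_zero n
  field_simp

/-- The quotient behaves like `(j!/i!) n^(i-j)`, so only the top index survives. -/
lemma tendsto_choose_div_choose {i j : ℕ} (h : i ≤ j) :
    Tendsto (fun n : ℕ => ((n.choose i : ℝ) / (n + 1 + j).choose j)) atTop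
      (𝓝 (if i = j then 1 else 0)) := by
  have shift : Tendsto (fun n : ℕ => n + 1 + j) atTop atTop := by
    simpa [add_assoc] using tendsto_add_atTop_nat (1 + j)
  have h1 := isEquivalent_choose i
  have h2 := (isEquivalent_choose j).comp_tendsto shift
  refine (IsEquivalent.tendsto_nhds_iff (h1.div h2)).mpr ?_
  have inv : Tendsto (fun n : ℕ => (1 : ℝ) / (n + 1 + j : ℕ)) atTop (𝓝 0) :=
    tendsto_one_div_atTop_nhds_zero_nat.comp shift
  have ratio : Tendsto (fun n : ℕ => (n : ℝ) / (n + 1 + j : ℕ)) atTop (𝓝 1) := by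
    have : Tendsto (fun n : ℕ => 1 - (1 + j : ℝ) * ((1 : ℝ) / (n + 1 + j : ℕ))) atTop (𝓝 1) := by
      simpa using (inv.const_mul (1 + j : ℝ)).const_sub 1
    refine this.congr fun n => ?_
    have : ((n + 1 + j : ℕ) : ℝ) ≠ 0 := by positivity
    push_cast at this ⊢
    field_simp
    ring
  have lim := ((ratio.pow i).mul (inv.pow (j - i))).mul_const ((j.factorial : ℝ) / i.factorial)
  have value : (1 : ℝ) ^ i * 0 ^ (j - i) * ((j.factorial : ℝ) / i.factorial)
      = if i = j then 1 else 0 := by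
    split_ifs with hij
    · subst hij
      simp [Nat.cast_ne_zero.mpr (Nat.factorial_ne_zero i)]
    · simp [show j - i ≠ 0 by omega]
  rw [value] at lim
  refine lim.congr fun n => ?_
  obtain ⟨d, rfl⟩ := Nat.exists_eq_add_of_le h
  have h3 : ((n + 1 + (i + d) : ℕ) : ℝ) ≠ 0 := by positivity
  simp only [Pi.div_apply, Function.comp_apply, Nat.add_sub_cancel_left]
  rw [div_pow, div_pow, one_pow]
  have := Nat.cast_ne_zero (R := ℝ).mpr (Nat.factorial_ne_zero i)
  have := Nat.cast_ne_zero (R := ℝ).mpr (Nat.factorial_ne_zero (i + d))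
  rw [pow_add]
  field_simp

/-- The polynomial `(n + 1) ∑ₖ wₖ bₙₖ` with the Bernstein weights of `μ` as coefficients. -/
def bernsteinDensity (μ : ℕ → ℂ) (n : ℕ) (x : ℝ) : ℂ :=
  (n + 1) * ∑ k ∈ Finset.range (n + 1),
    bernsteinWeight μ n k * (bernsteinPolynomial ℂ n k).eval (x : ℂ)

lemma continuous_bernsteinDensity (μ : ℕ → ℂ) (n : ℕ) : Continuous (bernsteinDensity μ n) := by
  unfold bernsteinDensity
  refine continuous_const.mul (continuous_finsetSum _ fun k _ => continuous_const.mul ?_)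
  exact (Polynomial.continuous _).comp continuous_ofReal

lemma integral_pow_mul_bernsteinDensity (μ : ℕ → ℂ) (n j : ℕ) :
    ∫ x in (0 : ℝ)..1, (x : ℂ) ^ j * bernsteinDensity μ n x
      = ∑ p ∈ Finset.HasAntidiagonal.antidiagonal j, (j.choose p.2 : ℂ) * μ p.1 *
          (((n.choose p.1 : ℝ) / (n + 1 + j).choose j : ℝ) : ℂ) := by
  have expand : ∀ x : ℝ, (x : ℂ) ^ j * bernsteinDensity μ n x
      = ∑ k ∈ Finset.range (n + 1), (n + 1) * bernsteinWeight μ n k *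
          ((x : ℂ) ^ j * (bernsteinPolynomial ℂ n k).eval (x : ℂ)) := by
    intro x
    rw [bernsteinDensity, Finset.mul_sum, Finset.mul_sum]
    exact Finset.sum_congr rfl fun k _ => by ring
  have cont : ∀ k, Continuous fun x : ℝ =>
      (x : ℂ) ^ j * (bernsteinPolynomial ℂ n k).eval (x : ℂ) := fun k =>
    (continuous_ofReal.pow j).mul ((Polynomial.continuous _).comp continuous_ofReal)
  simp only [expand]
  rw [intervalIntegral.integral_finsetSum fun k _ =>
    ((cont k).const_mul _).intervalIntegrable 0 1]
  have terms : ∀ k ∈ Finset.range (n + 1),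
      ∫ x in (0 : ℝ)..1, ((n : ℂ) + 1) * bernsteinWeight μ n k *
          ((x : ℂ) ^ j * (bernsteinPolynomial ℂ n k).eval (x : ℂ))
        = ∑ p ∈ Finset.HasAntidiagonal.antidiagonal j, ((j.choose p.2 : ℂ) / (n + 1 + j).choose j) *
            ((k.choose p.1 : ℂ) * bernsteinWeight μ n k) := by
    intro k hk
    rw [intervalIntegral.integral_const_mul, mul_right_comm,
      integral_pow_mul_bernstein (Nat.lt_succ_iff.mp (Finset.mem_range.mp hk)),
      Nat.add_choose_eq, Nat.cast_sum, Finset.sum_div, Finset.sum_mul]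
    exact Finset.sum_congr rfl fun p _ => by push_cast; ring
  rw [Finset.sum_congr rfl terms, Finset.sum_comm]
  refine Finset.sum_congr rfl fun p _ => ?_
  rw [← Finset.mul_sum, sum_choose_mul_bernsteinWeight]
  push_cast
  ring

lemma tendsto_integral_pow_mul_bernsteinDensity (μ : ℕ → ℂ) (j : ℕ) :
    Tendsto (fun n => ∫ x in (0 : ℝ)..1, (x : ℂ) ^ j * bernsteinDensity μ n x) atTop
      (𝓝 (μ j)) := by
  simp only [integral_pow_mul_bernsteinDensity]
  have lim : Tendsto (fun n : ℕ => ∑ p ∈ Finset.HasAntidiagonal.antidiagonal j, (j.choose p.2 : ℂ) * μ p.1 *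
      (((n.choose p.1 : ℝ) / (n + 1 + j).choose j : ℝ) : ℂ)) atTop
      (𝓝 (∑ p ∈ Finset.HasAntidiagonal.antidiagonal j, (j.choose p.2 : ℂ) * μ p.1 *
        ((if p.1 = j then 1 else 0 : ℝ) : ℂ))) :=
    tendsto_finsetSum _ fun p hp => Tendsto.const_mul _
      ((continuous_ofReal.tendsto _).comp
        (tendsto_choose_div_choose (Finset.HasAntidiagonal.antidiagonal.fst_le hp)))
  convert lim using 2
  rw [Finset.sum_eq_single (j, 0)]
  · simp
  · rintro ⟨a, b⟩ hp hne
    have hab : a + b = j := by simpa using hp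
    have : a ≠ j := by
      rintro rfl
      exact hne (by simpa using hab)
    simp [this]
  · simp

lemma integral_bernstein {n k : ℕ} (hk : k ≤ n) :
    ∫ x in (0 : ℝ)..1, (bernsteinPolynomial ℝ n k).eval x = 1 / (n + 1) := by
  have h := integral_pow_mul_bernstein hk 0
  have e : ∀ x : ℝ, (bernsteinPolynomial ℂ n k).eval (x : ℂ)
      = (((bernsteinPolynomial ℝ n k).eval x : ℝ) : ℂ) := by
    intro x; simp [bernsteinPolynomial]
  simp only [pow_zero, one_mul, e, intervalIntegral.integral_ofReal, Nat.choose_zero_right,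
    Nat.cast_one, div_one] at h
  have h' : ((n : ℝ) + 1) * ∫ x in (0 : ℝ)..1, (bernsteinPolynomial ℝ n k).eval x = 1 := by
    exact_mod_cast h
  field_simp
  linarith

/-- At each `x` the Bernstein values are convex weights, so Jensen moves the square inside the sum.
Each of them integrates to `1 / (n + 1)`, which reduces the factor `(n + 1)²` to `n + 1`. -/
lemma integral_norm_sq_bernsteinDensity_le (μ : ℕ → ℂ) (n : ℕ) :
    ∫ x in (0 : ℝ)..1, ‖bernsteinDensity μ n x‖ ^ 2
      ≤ (n + 1) * ∑ k ∈ Finset.range (n + 1), ‖bernsteinWeight μ n k‖ ^ 2 := by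
  have pointwise : ∀ x ∈ Icc (0 : ℝ) 1, ‖bernsteinDensity μ n x‖ ^ 2
      ≤ ∑ k ∈ Finset.range (n + 1), ((n : ℝ) + 1) ^ 2 * ‖bernsteinWeight μ n k‖ ^ 2 *
          (bernsteinPolynomial ℝ n k).eval x := by
    intro x hx
    have e : ∀ k, (bernsteinPolynomial ℂ n k).eval (x : ℂ)
        = (((bernsteinPolynomial ℝ n k).eval x : ℝ) : ℂ) := by
      intro k; simp [bernsteinPolynomial]
    have nonneg : ∀ k ∈ Finset.range (n + 1), 0 ≤ (bernsteinPolynomial ℝ n k).eval x := by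
      intro k _
      have := hx.1
      have : 0 ≤ 1 - x := sub_nonneg.mpr hx.2
      simp only [bernsteinPolynomial, Polynomial.eval_mul, Polynomial.eval_natCast,
        Polynomial.eval_pow, Polynomial.eval_X, Polynomial.eval_sub, Polynomial.eval_one]
      positivity
    have total : ∑ k ∈ Finset.range (n + 1), (bernsteinPolynomial ℝ n k).eval x = 1 := by
      have := congrArg (Polynomial.eval x) (bernsteinPolynomial.sum ℝ n)
      simpa [Polynomial.eval_finsetSum] using this
    have jensen := Real.pow_arith_mean_le_arith_mean_pow (Finset.range (n + 1))
      (fun k => (bernsteinPolynomial ℝ n k).eval x) (fun k => ‖bernsteinWeight μ n k‖)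
      nonneg total (fun k _ => norm_nonneg _) 2
    have bound : ‖bernsteinDensity μ n x‖ ≤ (n + 1) * ∑ k ∈ Finset.range (n + 1),
        (bernsteinPolynomial ℝ n k).eval x * ‖bernsteinWeight μ n k‖ := by
      rw [bernsteinDensity, norm_mul]
      have : ‖(n : ℂ) + 1‖ = n + 1 := by exact_mod_cast Complex.norm_natCast (n + 1)
      rw [this]
      gcongr
      refine (norm_sum_le _ _).trans (Finset.sum_le_sum fun k hk => ?_)
      rw [norm_mul, e, Complex.norm_real, Real.norm_of_nonneg (nonneg k hk), mul_comm]
    calc ‖bernsteinDensity μ n x‖ ^ 2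
        ≤ ((n + 1) * ∑ k ∈ Finset.range (n + 1),
            (bernsteinPolynomial ℝ n k).eval x * ‖bernsteinWeight μ n k‖) ^ 2 := by gcongr
      _ ≤ ((n : ℝ) + 1) ^ 2 * ∑ k ∈ Finset.range (n + 1),
            (bernsteinPolynomial ℝ n k).eval x * ‖bernsteinWeight μ n k‖ ^ 2 := by
          rw [mul_pow]; gcongr
      _ = _ := by
          rw [Finset.mul_sum]
          exact Finset.sum_congr rfl fun k _ => by ring
  have ccont : ∀ k, Continuous fun x : ℝ => ((n : ℝ) + 1) ^ 2 * ‖bernsteinWeight μ n k‖ ^ 2 *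
      (bernsteinPolynomial ℝ n k).eval x := fun k =>
    continuous_const.mul (Polynomial.continuous _)
  refine (intervalIntegral.integral_mono_on zero_le_one
    (((continuous_bernsteinDensity μ n).norm.pow 2).intervalIntegrable 0 1)
    ((continuous_finsetSum _ fun k _ => ccont k).intervalIntegrable 0 1) pointwise).trans ?_
  rw [intervalIntegral.integral_finsetSum fun k _ => (ccont k).intervalIntegrable 0 1,
    Finset.mul_sum]
  refine le_of_eq (Finset.sum_congr rfl fun k hk => ?_)
  rw [intervalIntegral.integral_const_mul,
    integral_bernstein (Nat.lt_succ_iff.mp (Finset.mem_range.mp hk))]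
  field_simp

/-! ### Weak compactness and the density -/

/-- Banach–Alaoglu along a free ultrafilter: a single limit `f` serves every `h`, and where the
pairings converge in the ordinary sense the ultrafilter limit must agree. -/
lemma exists_weak_limit {H : Type*} [NormedAddCommGroup H] [InnerProductSpace ℂ H]
    [CompleteSpace H] {R : ℝ} (F : ℕ → H) (hF : ∀ n, ‖F n‖ ≤ R) :
    ∃ f : H, ∀ (h : H) (c : ℂ), Tendsto (fun n => inner ℂ (F n) h) atTop (𝓝 c) →
      inner ℂ f h = c := by
  have compact := WeakDual.isCompact_closedBall (𝕜 := ℂ) (E := H) 0 R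
  let φ : ℕ → WeakDual ℂ H := fun n =>
    StrongDual.toWeakDual (InnerProductSpace.toDual ℂ H (F n))
  obtain ⟨ψ, -, hψ⟩ := compact.ultrafilter_le_nhds ((hyperfilter ℕ).map φ) (by
    rw [le_principal_iff]
    refine Ultrafilter.mem_map.mpr (Filter.univ_mem' fun n => ?_)
    simpa [φ] using hF n)
  refine ⟨(InnerProductSpace.toDual ℂ H).symm (WeakDual.toStrongDual ψ), fun h c hc => ?_⟩
  rw [InnerProductSpace.toDual_symm_apply]
  have h1 : Tendsto (fun n => φ n h) (hyperfilter ℕ) (𝓝 (ψ h)) :=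
    ((WeakDual.eval_continuous h).tendsto ψ).comp hψ
  have h2 : Tendsto (fun n => φ n h) (hyperfilter ℕ) (𝓝 c) :=
    hc.mono_left (Nat.hyperfilter_le_atTop)
  exact tendsto_nhds_unique h1 h2

lemma memLp_two_of_continuous {f : ℝ → ℂ} (hf : Continuous f) :
    MemLp f 2 (volume.restrict (Ioc (0 : ℝ) 1)) := by
  obtain ⟨C, hC⟩ := isCompact_Icc.exists_bound_of_continuousOn (s := Icc (0 : ℝ) 1) hf.continuousOn
  refine MemLp.of_bound hf.aestronglyMeasurable C ?_
  filter_upwards [ae_restrict_mem measurableSet_Ioc] with x hx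
  exact hC x (Ioc_subset_Icc_self hx)

/-- Hausdorff's theorem for the exponent two: the sequences satisfying the condition are the
moment sequences of square-integrable densities. -/
theorem exists_density_of_hausdorffCondition {μ : ℕ → ℂ} (hμ : HausdorffCondition 2 μ) :
    ∃ f : ℝ → ℂ, MemLp f 2 (volume.restrict (Ioc (0 : ℝ) 1)) ∧
      ∀ k : ℕ, ∫ x in Ioc (0 : ℝ) 1, (x : ℂ) ^ k * f x = μ k := by
  obtain ⟨M, hM, hb⟩ := hμ
  -- The inner product is conjugate-linear in its first slot; conjugating here and again on the
  -- limit makes the pairing with `x^k` the plain moment.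
  have cont : ∀ n, Continuous fun x => conj (bernsteinDensity μ n x) := fun n =>
    continuous_conj.comp (continuous_bernsteinDensity μ n)
  let F : ℕ → Lp ℂ 2 (volume.restrict (Ioc (0 : ℝ) 1)) := fun n =>
    (memLp_two_of_continuous (cont n)).toLp _
  have hF : ∀ n, ‖F n‖ ≤ √M := by
    intro n
    refine Real.le_sqrt_of_sq_le ?_
    have h1 : ‖F n‖ ^ 2 = ∫ x in (0 : ℝ)..1, ‖bernsteinDensity μ n x‖ ^ 2 := by
      have h2 : inner ℂ (F n) (F n)
          = ((∫ x in (0 : ℝ)..1, ‖bernsteinDensity μ n x‖ ^ 2 : ℝ) : ℂ) := by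
        rw [L2.inner_def, intervalIntegral.integral_of_le zero_le_one, ← integral_complex_ofReal]
        refine integral_congr_ae ?_
        filter_upwards [(memLp_two_of_continuous (cont n)).coeFn_toLp] with x hx
        rw [hx, inner_self_eq_norm_sq_to_K]
        simp
      rw [inner_self_eq_norm_sq_to_K, ← RCLike.ofReal_pow] at h2
      exact Complex.ofReal_injective h2
    rw [h1]
    refine (integral_norm_sq_bernsteinDensity_le μ n).trans ?_
    have h3 := hb n
    norm_num at h3
    exact h3.le
  obtain ⟨f, hf⟩ := exists_weak_limit F hF
  refine ⟨fun x => conj (f x), ?_, fun k => ?_⟩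
  · exact (Lp.memLp f).star
  · have cp : Continuous fun x : ℝ => (x : ℂ) ^ k := continuous_ofReal.pow k
    have pair : ∀ h : Lp ℂ 2 (volume.restrict (Ioc (0 : ℝ) 1)),
        inner ℂ h ((memLp_two_of_continuous cp).toLp _)
          = ∫ x in Ioc (0 : ℝ) 1, (x : ℂ) ^ k * conj (h x) := by
      intro h
      rw [L2.inner_def]
      refine integral_congr_ae ?_
      filter_upwards [(memLp_two_of_continuous cp).coeFn_toLp] with x hx
      rw [hx, RCLike.inner_apply]
    rw [← pair]
    refine hf _ _ ((tendsto_integral_pow_mul_bernsteinDensity μ k).congr fun n => ?_)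
    rw [pair, intervalIntegral.integral_of_le zero_le_one]
    refine integral_congr_ae ?_
    filter_upwards [(memLp_two_of_continuous (cont n)).coeFn_toLp] with x hx
    rw [hx, Complex.conj_conj]

/-! ### Uniform control of the logarithmic singularity -/

lemma integrable_indicator_abs_rpow :
    Integrable (Set.indicator (Icc (-2 : ℝ) 2) fun y => |y| ^ (-1 / 2 : ℝ)) := by
  rw [integrable_indicator_iff measurableSet_Icc, ← Icc_union_Icc_eq_Icc (b := 0)
    (by norm_num) (by norm_num)]
  have right : IntegrableOn (fun y : ℝ => |y| ^ (-1 / 2 : ℝ)) (Icc 0 2) := by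
    have := (intervalIntegral.intervalIntegrable_rpow' (a := 0) (b := 2) (r := -1 / 2)
      (by norm_num)).1
    rw [← integrableOn_Icc_iff_integrableOn_Ioc] at this
    refine this.congr_fun (fun y hy => ?_) measurableSet_Icc
    simp [abs_of_nonneg hy.1]
  refine IntegrableOn.union ?_ right
  have := right.comp_neg
  simpa using this

/-- `‖1 - xz‖ ^ (-1/2)` is integrable on the unit interval, with a bound uniform in `z`. -/
lemma exists_uniform_bound_rpow : ∃ C : ℝ, ∀ z : ℂ, ∃ B : ℝ → ℝ,
    IntegrableOn B (Ioc 0 1) ∧ ∫ x in Ioc (0 : ℝ) 1, B x ≤ C ∧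
    ∀ᵐ (x : ℝ) ∂volume.restrict (Ioc (0 : ℝ) 1), ‖1 - (x : ℂ) * z‖ ^ (-1 / 2 : ℝ) ≤ B x := by
  set φ : ℝ → ℝ := Set.indicator (Icc (-2 : ℝ) 2) fun y => |y| ^ (-1 / 2 : ℝ) with hφ
  have φ_nonneg : ∀ y, 0 ≤ φ y := fun y => Set.indicator_nonneg (fun _ _ => by positivity) y
  -- The constant `2 = (1/4)^(-1/2)` covers `Re z ≤ 1/2`. For `Re z > 1/2` the real part of `1 - xz`
  -- vanishes at `x = 1 / Re z`, and the translate of `φ` to that point dominates; translation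
  -- invariance makes its integral independent of `z`.
  refine ⟨2 + 2 * ∫ y, φ y, fun z => ⟨fun x => 2 + 2 * φ (x - z.re⁻¹), ?_, ?_, ?_⟩⟩
  · exact (integrable_const _).add
      ((integrable_indicator_abs_rpow.comp_sub_right z.re⁻¹).integrableOn.const_mul 2)
  · have shifted := integrable_indicator_abs_rpow.comp_sub_right z.re⁻¹
    rw [integral_add (integrable_const _) (shifted.integrableOn.const_mul 2),
      integral_const_mul]
    have : ∫ x in Ioc (0 : ℝ) 1, φ (x - z.re⁻¹) ≤ ∫ y, φ y := by
      rw [← integral_sub_right_eq_self φ z.re⁻¹]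
      exact setIntegral_le_integral shifted (ae_of_all _ fun x => φ_nonneg _)
    simp only [integral_const, measureReal_restrict_apply_univ, Real.volume_real_Ioc, sub_zero,
      max_eq_left (zero_le_one' ℝ), smul_eq_mul, one_mul]
    exact add_le_add_right (mul_le_mul_of_nonneg_left this zero_le_two) 2
  · have ne : ∀ᵐ (x : ℝ) ∂volume.restrict (Ioc (0 : ℝ) 1), x ≠ z.re⁻¹ :=
      ae_restrict_of_ae (Measure.ae_ne volume _)
    filter_upwards [ae_restrict_mem measurableSet_Ioc, ne] with x hx hne
    have re_le : |1 - x * z.re| ≤ ‖1 - (x : ℂ) * z‖ := by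
      simpa using Complex.abs_re_le_norm (1 - (x : ℂ) * z)
    rcases le_or_gt z.re (1 / 2) with h | h
    · have h1 : (1 / 4 : ℝ) ≤ ‖1 - (x : ℂ) * z‖ := by
        refine le_trans ?_ ((le_abs_self _).trans re_le)
        nlinarith [hx.1, hx.2]
      have h2 := Real.rpow_le_rpow_of_nonpos (by norm_num) h1 (by norm_num : (-1 / 2 : ℝ) ≤ 0)
      have h3 : (1 / 4 : ℝ) ^ (-1 / 2 : ℝ) = 2 := by
        rw [show (1 / 4 : ℝ) = 2 ^ (-2 : ℝ) by norm_num [Real.rpow_neg], ← Real.rpow_mul (by norm_num)]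
        norm_num
      have := φ_nonneg (x - z.re⁻¹)
      linarith
    · have hz : 0 < z.re := by linarith
      have inv_lt : z.re⁻¹ < 2 := by
        rw [inv_lt_comm₀ hz (by norm_num)]; linarith
      have inv_pos : 0 < z.re⁻¹ := inv_pos.mpr hz
      have y_pos : 0 < |x - z.re⁻¹| := abs_pos.mpr (sub_ne_zero.mpr hne)
      have h1 : 1 / 4 * |x - z.re⁻¹| ≤ ‖1 - (x : ℂ) * z‖ := by
        refine le_trans ?_ re_le
        have : 1 - x * z.re = -(z.re * (x - z.re⁻¹)) := by field_simp; ring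
        rw [this, abs_neg, abs_mul, abs_of_pos hz]
        gcongr
        linarith
      have h2 := Real.rpow_le_rpow_of_nonpos (by positivity) h1
        (by norm_num : (-1 / 2 : ℝ) ≤ 0)
      have h3 : (1 / 4 : ℝ) ^ (-1 / 2 : ℝ) = 2 := by
        rw [show (1 / 4 : ℝ) = 2 ^ (-2 : ℝ) by norm_num [Real.rpow_neg], ← Real.rpow_mul (by norm_num)]
        norm_num
      rw [Real.mul_rpow (by norm_num) y_pos.le, h3] at h2
      have mem : x - z.re⁻¹ ∈ Icc (-2 : ℝ) 2 := ⟨by linarith [hx.1], by linarith [hx.2]⟩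
      have : φ (x - z.re⁻¹) = |x - z.re⁻¹| ^ (-1 / 2 : ℝ) := by
        rw [hφ, Set.indicator_of_mem mem]
      rw [this]
      linarith

/-- The logarithm with its real part cut off at `-m`. -/
def truncLog (m : ℝ) (w : ℂ) : ℂ := Complex.log w + ((max (Real.log ‖w‖) (-m) - Real.log ‖w‖ : ℝ) : ℂ)

lemma norm_truncLog_le {m : ℝ} (hm : 0 ≤ m) (w : ℂ) : ‖truncLog m w‖ ≤ ‖w‖ + m + Real.pi := by
  refine (Complex.norm_le_abs_re_add_abs_im _).trans ?_
  have h1 : (truncLog m w).re = max (Real.log ‖w‖) (-m) := by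
    simp [truncLog, Complex.log_re]
  have h2 : (truncLog m w).im = w.arg := by simp [truncLog, Complex.log_im]
  rw [h1, h2]
  refine add_le_add (abs_le.mpr ⟨?_, max_le ?_ ?_⟩) (Complex.abs_arg_le_pi w)
  · have := le_max_right (Real.log ‖w‖) (-m)
    linarith [norm_nonneg w]
  · linarith [Real.log_le_self (norm_nonneg w)]
  · linarith [norm_nonneg w]

/-- The part cut off is at most `4 e^{-m/4} ‖w‖^{-1/4}`, by `t ≤ e^t`. Then `2ab ≤ a² + b²`
separates the factor `c`, later `f x`, from the singular weight. -/
lemma norm_mul_log_sub_truncLog_le (m : ℝ) {w : ℂ} (hw : w ≠ 0) (c : ℂ) :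
    ‖c * (Complex.log w - truncLog m w)‖
      ≤ 2 * Real.exp (-m / 4) * (‖c‖ ^ 2 + ‖w‖ ^ (-1 / 2 : ℝ)) := by
  have hw' : 0 < ‖w‖ := norm_pos_iff.mpr hw
  have h1 : ‖Complex.log w - truncLog m w‖ = max (Real.log ‖w‖) (-m) - Real.log ‖w‖ := by
    have : Complex.log w - truncLog m w
        = -((max (Real.log ‖w‖) (-m) - Real.log ‖w‖ : ℝ) : ℂ) := by rw [truncLog]; ring
    rw [this, norm_neg, Complex.norm_real, Real.norm_of_nonneg]
    linarith [le_max_left (Real.log ‖w‖) (-m)]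
  have h2 : max (Real.log ‖w‖) (-m) - Real.log ‖w‖
      ≤ 4 * (Real.exp (-m / 4) * Real.exp (-Real.log ‖w‖ / 4)) := by
    rw [← Real.exp_add, sub_le_iff_le_add]
    have := Real.add_one_le_exp (-m / 4 + -Real.log ‖w‖ / 4)
    have := Real.exp_pos (-m / 4 + -Real.log ‖w‖ / 4)
    exact max_le (by linarith) (by linarith)
  have h3 : ‖w‖ ^ (-1 / 2 : ℝ) = Real.exp (-Real.log ‖w‖ / 4) ^ 2 := by
    rw [Real.rpow_def_of_pos hw', ← Real.exp_nat_mul]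
    congr 1
    push_cast
    ring
  rw [norm_mul, h1, h3]
  set t := Real.exp (-Real.log ‖w‖ / 4)
  have he := Real.exp_pos (-m / 4)
  calc ‖c‖ * (max (Real.log ‖w‖) (-m) - Real.log ‖w‖)
      ≤ ‖c‖ * (4 * (Real.exp (-m / 4) * t)) := by gcongr
    _ = 2 * Real.exp (-m / 4) * (2 * ‖c‖ * t) := by ring
    _ ≤ _ := by gcongr; nlinarith [sq_nonneg (‖c‖ - t)]

lemma ae_one_sub_mul_ne_zero (z : ℂ) :
    ∀ᵐ (x : ℝ) ∂volume.restrict (Ioc (0 : ℝ) 1), 1 - (x : ℂ) * z ≠ 0 := by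
  refine ae_restrict_of_ae ?_
  have : {x : ℝ | 1 - (x : ℂ) * z = 0}.Subsingleton := by
    intro x hx y hy
    simp only [mem_ofPred_eq, sub_eq_zero] at hx hy
    have hz : z ≠ 0 := by rintro rfl; simp at hx
    exact_mod_cast mul_right_cancel₀ hz (hx.symm.trans hy)
  simpa [ae_iff] using this.measure_zero volume

lemma measurable_truncLog (m : ℝ) : Measurable (truncLog m) := by
  unfold truncLog
  fun_prop

variable {f : ℝ → ℂ}

lemma integrable_mul_truncLog (hf : MemLp f 2 (volume.restrict (Ioc (0 : ℝ) 1))) {m : ℝ}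
    (hm : 0 ≤ m) (z : ℂ) :
    Integrable (fun x : ℝ => f x * truncLog m (1 - x * z)) (volume.restrict (Ioc (0 : ℝ) 1)) := by
  have hint : Integrable f (volume.restrict (Ioc (0 : ℝ) 1)) := hf.integrable (by norm_num)
  refine (hint.norm.mul_const (1 + ‖z‖ + m + Real.pi)).mono'
    (hf.1.mul ((measurable_truncLog m).comp (by fun_prop)).aestronglyMeasurable) ?_
  filter_upwards [ae_restrict_mem measurableSet_Ioc] with x hx
  rw [norm_mul]
  gcongr
  refine (norm_truncLog_le hm _).trans ?_
  gcongr
  refine (norm_sub_le _ _).trans ?_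
  rw [norm_one, norm_mul, Complex.norm_real, Real.norm_of_nonneg hx.1.le]
  nlinarith [hx.2, norm_nonneg z]

lemma exists_integral_log_sub_truncLog_le (hf : MemLp f 2 (volume.restrict (Ioc (0 : ℝ) 1))) :
    ∃ K : ℝ, ∀ (m : ℝ) (z : ℂ),
      Integrable (fun x : ℝ => f x * (Complex.log (1 - x * z) - truncLog m (1 - x * z)))
        (volume.restrict (Ioc (0 : ℝ) 1)) ∧
      ‖∫ x in Ioc (0 : ℝ) 1, f x * (Complex.log (1 - x * z) - truncLog m (1 - x * z))‖
        ≤ 2 * Real.exp (-m / 4) * K := by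
  obtain ⟨C, hC⟩ := exists_uniform_bound_rpow
  have hsq : Integrable (fun x => ‖f x‖ ^ 2) (volume.restrict (Ioc (0 : ℝ) 1)) :=
    hf.integrable_norm_pow (by norm_num)
  refine ⟨(∫ x in Ioc (0 : ℝ) 1, ‖f x‖ ^ 2) + C, fun m z => ?_⟩
  obtain ⟨B, hB, hBC, hle⟩ := hC z
  have bound : ∀ᵐ (x : ℝ) ∂volume.restrict (Ioc (0 : ℝ) 1),
      ‖f x * (Complex.log (1 - x * z) - truncLog m (1 - x * z))‖
        ≤ 2 * Real.exp (-m / 4) * (‖f x‖ ^ 2 + B x) := by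
    filter_upwards [hle, ae_one_sub_mul_ne_zero z] with x hx hne
    refine (norm_mul_log_sub_truncLog_le m hne (f x)).trans ?_
    gcongr
  have bint := (hsq.add hB).const_mul (2 * Real.exp (-m / 4))
  refine ⟨bint.mono' (hf.1.mul ?_) bound, ?_⟩
  · exact ((Complex.measurable_log.comp (by fun_prop)).sub
      ((measurable_truncLog m).comp (by fun_prop))).aestronglyMeasurable
  · refine (norm_integral_le_of_norm_le bint bound).trans ?_
    simp only [Pi.add_apply]
    rw [integral_const_mul, integral_add hsq hB]
    gcongr

lemma integrable_mul_log (hf : MemLp f 2 (volume.restrict (Ioc (0 : ℝ) 1))) (z : ℂ) :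
    Integrable (fun x : ℝ => f x * Complex.log (1 - x * z))
      (volume.restrict (Ioc (0 : ℝ) 1)) := by
  obtain ⟨K, hK⟩ := exists_integral_log_sub_truncLog_le hf
  refine ((hK 0 z).1.add (integrable_mul_truncLog hf le_rfl z)).congr (ae_of_all _ fun x => ?_)
  simp only [Pi.add_apply]
  ring

/-! ### Continuity and holomorphy of the logarithmic transform -/

/-- The transform `z ↦ -∫₀¹ f(x) log(1 - xz) dx`. -/
def logTransform (f : ℝ → ℂ) (z : ℂ) : ℂ := -∫ x in Ioc (0 : ℝ) 1, f x * Complex.log (1 - x * z)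

/-- Uniform limit of the truncated transforms. The hypothesis is relative to `S` so that it also
covers one-sided continuity of the logarithm on its cut. -/
theorem continuousOn_logTransform (hf : MemLp f 2 (volume.restrict (Ioc (0 : ℝ) 1))) {S : Set ℂ}
    (hS : ∀ z₀ ∈ S, ∀ᵐ (x : ℝ) ∂volume.restrict (Ioc (0 : ℝ) 1),
      ContinuousWithinAt (fun z : ℂ => Complex.log (1 - (x : ℂ) * z)) S z₀) :
    ContinuousOn (logTransform f) S := by
  have hint : Integrable f (volume.restrict (Ioc (0 : ℝ) 1)) := hf.integrable (by norm_num)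
  let F : ℕ → ℂ → ℂ := fun m z => -∫ x in Ioc (0 : ℝ) 1, f x * truncLog m (1 - x * z)
  have hF : ∀ m : ℕ, ContinuousOn (F m) S := by
    intro m z₀ hz₀
    refine ContinuousWithinAt.neg ?_
    refine continuousWithinAt_of_dominated
      (bound := fun x => ‖f x‖ * (1 + (‖z₀‖ + 1) + m + Real.pi)) ?_ ?_ ?_ ?_
    · exact Eventually.of_forall fun z => (integrable_mul_truncLog hf m.cast_nonneg z).1
    · have near : ∀ᶠ z in 𝓝[S] z₀, ‖z‖ < ‖z₀‖ + 1 :=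
        nhdsWithin_le_nhds (continuous_norm.continuousAt.eventually_lt_const (by linarith))
      filter_upwards [near] with z hz
      filter_upwards [ae_restrict_mem measurableSet_Ioc] with x hx
      rw [norm_mul]
      gcongr
      refine (norm_truncLog_le m.cast_nonneg _).trans ?_
      gcongr
      refine (norm_sub_le _ _).trans ?_
      rw [norm_one, norm_mul, Complex.norm_real, Real.norm_of_nonneg hx.1.le]
      nlinarith [hx.2, norm_nonneg z]
    · exact hint.norm.mul_const _
    · filter_upwards [hS z₀ hz₀, ae_one_sub_mul_ne_zero z₀] with x hx hne
      -- The cutoff alters only the real part, so `truncLog` inherits the one-sided continuity of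
      -- `Complex.log`.
      have hlog : ContinuousWithinAt (fun z : ℂ => Real.log ‖1 - (x : ℂ) * z‖) S z₀ :=
        (ContinuousAt.log (f := fun z : ℂ => ‖1 - (x : ℂ) * z‖) (by fun_prop)
          (norm_ne_zero_iff.mpr hne)).continuousWithinAt
      exact continuousWithinAt_const.mul (hx.add (continuous_ofReal.continuousAt.comp_continuousWithinAt
        ((hlog.max continuousWithinAt_const).sub hlog)))
  obtain ⟨K, hK⟩ := exists_integral_log_sub_truncLog_le hf
  have unif : TendstoUniformlyOn F (logTransform f) atTop S := by
    rw [Metric.tendstoUniformlyOn_iff]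
    intro ε hε
    have lim : Tendsto (fun m : ℕ => 2 * Real.exp (-(m : ℝ) / 4) * K) atTop (𝓝 0) := by
      have : Tendsto (fun m : ℕ => Real.exp (-((m : ℝ) / 4))) atTop (𝓝 0) :=
        Real.tendsto_exp_neg_atTop_nhds_zero.comp
          (tendsto_natCast_atTop_atTop.atTop_div_const (by norm_num))
      simpa [neg_div] using (this.const_mul 2).mul_const K
    filter_upwards [lim.eventually_lt_const hε] with m hm z _
    refine lt_of_le_of_lt ?_ hm
    have e : logTransform f z - F m z
        = -∫ x in Ioc (0 : ℝ) 1, f x * (Complex.log (1 - x * z) - truncLog m (1 - x * z)) := by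
      simp only [mul_sub]
      rw [integral_sub (integrable_mul_log hf z) (integrable_mul_truncLog hf m.cast_nonneg z),
        logTransform]
      simp only [F]
      ring
    rw [dist_eq_norm, e, norm_neg]
    exact (hK m z).2
  exact unif.continuousOn (Frequently.of_forall hF)

lemma one_sub_mul_mem_slitPlane {z : ℂ} (hz : 1 - z ∈ slitPlane) {x : ℝ} (hx : x ∈ Icc (0 : ℝ) 1) :
    1 - (x : ℂ) * z ∈ slitPlane := by
  rcases hx.1.eq_or_lt with rfl | h0
  · simp
  · rw [Complex.mem_slitPlane_iff] at hz ⊢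
    simp at hz ⊢
    rcases hz with h | h
    · left
      nlinarith [hx.2]
    · exact Or.inr ⟨h0.ne', h⟩

/-- The branch point `z = 1` is included: there `1 - xz` leaves the slit plane only at the null
point `x = 1`. -/
lemma continuousOn_logTransform_of_slit (hf : MemLp f 2 (volume.restrict (Ioc (0 : ℝ) 1))) :
    ContinuousOn (logTransform f) {z | z.im = 0 → z.re ≤ 1} := by
  refine continuousOn_logTransform hf fun z₀ hz₀ => ?_
  have ne : ∀ᵐ (x : ℝ) ∂volume.restrict (Ioc (0 : ℝ) 1), x ≠ 1 := ae_restrict_of_ae (Measure.ae_ne volume _)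
  filter_upwards [ae_restrict_mem measurableSet_Ioc, ne] with x hx hne
  refine ContinuousAt.continuousWithinAt (ContinuousAt.clog (by fun_prop) ?_)
  have hx1 : x < 1 := lt_of_le_of_ne hx.2 hne
  rw [Complex.mem_slitPlane_iff]
  simp
  by_cases h : z₀.im = 0
  · left
    have := hz₀ h
    nlinarith [hx.1]
  · exact Or.inr ⟨hx.1.ne', h⟩

/-- On the negative axis `Complex.log` takes its boundary values from above, and `z ↦ 1 - xz`
carries the lower half-plane to the upper. Hence on the cut `logTransform f` equals its limit from
below. -/
lemma continuousOn_logTransform_lower (hf : MemLp f 2 (volume.restrict (Ioc (0 : ℝ) 1))) :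
    ContinuousOn (logTransform f) {z | z.im ≤ 0} := by
  refine continuousOn_logTransform hf fun z₀ hz₀ => ?_
  filter_upwards [ae_restrict_mem measurableSet_Ioc, ae_one_sub_mul_ne_zero z₀] with x hx hne
  have maps : MapsTo (fun z : ℂ => 1 - (x : ℂ) * z) {z | z.im ≤ 0} {w | 0 ≤ w.im} := by
    intro z hz
    simp at hz ⊢
    nlinarith [hx.1]
  have inner : ContinuousWithinAt (fun z : ℂ => 1 - (x : ℂ) * z) {z | z.im ≤ 0} z₀ := by fun_prop
  refine ContinuousWithinAt.comp (g := Complex.log) (t := {w | 0 ≤ w.im}) ?_ inner maps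
  by_cases h : 1 - (x : ℂ) * z₀ ∈ slitPlane
  · exact (continuousAt_clog h).continuousWithinAt
  · rw [Complex.mem_slitPlane_iff, not_or, not_lt, not_not] at h
    refine continuousWithinAt_log_of_re_neg_of_im_zero (lt_of_le_of_ne h.1 fun h0 => hne ?_) h.2
    exact Complex.ext h0 h.2

theorem differentiableOn_logTransform (hf : MemLp f 2 (volume.restrict (Ioc (0 : ℝ) 1))) :
    DifferentiableOn ℂ (logTransform f) {z | 1 - z ∈ slitPlane} := by
  intro z₀ hz₀
  have hint : Integrable f (volume.restrict (Ioc (0 : ℝ) 1)) := hf.integrable (by norm_num)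
  have hopen : IsOpen {z : ℂ | 1 - z ∈ slitPlane} :=
    isOpen_slitPlane.preimage (by fun_prop)
  obtain ⟨r, hr, hball⟩ := Metric.nhds_basis_closedBall.mem_iff.mp (hopen.mem_nhds hz₀)
  have compact : IsCompact (Icc (0 : ℝ) 1 ×ˢ Metric.closedBall z₀ r) :=
    isCompact_Icc.prod (isCompact_closedBall z₀ r)
  obtain ⟨p, hp, hmin⟩ := compact.exists_isMinOn
    ⟨(0, z₀), ⟨by simp, Metric.mem_closedBall_self hr.le⟩⟩
    (f := fun p : ℝ × ℂ => ‖1 - (p.1 : ℂ) * p.2‖) (by fun_prop)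
  -- The minimum of `‖1 - xz‖` over a compact set, positive there; it dominates the derivative of
  -- the logarithm.
  set δ := ‖1 - (p.1 : ℂ) * p.2‖
  have hδ : 0 < δ :=
    norm_pos_iff.mpr (slitPlane_ne_zero (one_sub_mul_mem_slitPlane (hball hp.2) hp.1))
  have key := hasDerivAt_integral_of_dominated_loc_of_deriv_le
    (μ := volume.restrict (Ioc (0 : ℝ) 1)) (s := Metric.closedBall z₀ r) (x₀ := z₀)
    (F := fun z x => f x * Complex.log (1 - x * z))
    (F' := fun z x => f x * (-(x : ℂ) / (1 - x * z)))
    (bound := fun x => ‖f x‖ * (1 / δ))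
    (Metric.closedBall_mem_nhds z₀ hr)
    (Eventually.of_forall fun z => (integrable_mul_log hf z).1)
    (integrable_mul_log hf z₀)
    (hf.1.mul (Measurable.aestronglyMeasurable (by fun_prop))) ?_ (hint.norm.mul_const _) ?_
  · exact (key.2.neg).differentiableAt.differentiableWithinAt
  · filter_upwards [ae_restrict_mem measurableSet_Ioc] with x hx z hz
    rw [norm_mul, norm_div, norm_neg, Complex.norm_real, Real.norm_of_nonneg hx.1.le]
    gcongr
    · exact hx.2
    · exact hmin (show (x, z) ∈ _ from ⟨Ioc_subset_Icc_self hx, hz⟩)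
  · filter_upwards [ae_restrict_mem measurableSet_Ioc] with x hx z hz
    have h1 : HasDerivAt (fun z : ℂ => 1 - (x : ℂ) * z) (-(x : ℂ)) z := by
      simpa using ((hasDerivAt_id z).const_mul (x : ℂ)).const_sub 1
    exact (h1.clog (one_sub_mul_mem_slitPlane (hball hz) (Ioc_subset_Icc_self hx))).const_mul (f x)

/-! ### The power series on the closed unit disc -/

lemma integral_norm_mul_pow_le (hf : MemLp f 2 (volume.restrict (Ioc (0 : ℝ) 1))) {n : ℕ}
    (hn : 1 ≤ n) :
    ∫ x in Ioc (0 : ℝ) 1, ‖f x‖ * x ^ n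
      ≤ ((∫ x in Ioc (0 : ℝ) 1, ‖f x‖ ^ 2) + 1) * (n : ℝ) ^ (-1 / 2 : ℝ) := by
  have hsq : Integrable (fun x => ‖f x‖ ^ 2) (volume.restrict (Ioc (0 : ℝ) 1)) :=
    hf.integrable_norm_pow (by norm_num)
  have n_pos : (0 : ℝ) < n := by exact_mod_cast hn
  -- This choice balances `ε ‖f‖²` against `x^(2n) / ε`, whose integral is at most `1 / (ε n)`.
  set ε : ℝ := (n : ℝ) ^ (-1 / 2 : ℝ) with hε
  have ε_pos : 0 < ε := Real.rpow_pos_of_pos n_pos _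
  have ε_sq : ε ^ 2 = 1 / n := by
    rw [hε, ← Real.rpow_natCast, ← Real.rpow_mul n_pos.le, one_div, ← Real.rpow_neg_one]
    norm_num
  have pint : Integrable (fun x : ℝ => x ^ (2 * n)) (volume.restrict (Ioc (0 : ℝ) 1)) :=
    ((continuous_pow _).integrableOn_Icc).mono_set Ioc_subset_Icc_self
  have pval : ∫ x in Ioc (0 : ℝ) 1, x ^ (2 * n) = 1 / (2 * n + 1) := by
    rw [← intervalIntegral.integral_of_le zero_le_one, integral_pow]
    simp
  have bint := (hsq.const_mul ε).add (pint.const_mul (1 / ε))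
  calc ∫ x in Ioc (0 : ℝ) 1, ‖f x‖ * x ^ n
      ≤ ∫ x in Ioc (0 : ℝ) 1, (ε * ‖f x‖ ^ 2 + 1 / ε * x ^ (2 * n)) := by
        refine integral_mono_of_nonneg ?_ bint (ae_of_all _ fun x => ?_)
        · filter_upwards [ae_restrict_mem measurableSet_Ioc] with x hx
          have := hx.1.le
          simp only [Pi.zero_apply]
          positivity
        · have h := sq_nonneg (ε * ‖f x‖ - x ^ n)
          have h0 := sq_nonneg (ε * ‖f x‖ + x ^ n)
          have e : ε * ‖f x‖ ^ 2 + 1 / ε * x ^ (2 * n)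
              = 1 / ε * ((ε * ‖f x‖) ^ 2 + (x ^ n) ^ 2) := by
            field_simp
            ring
          have e2 : ‖f x‖ * x ^ n = 1 / ε * (ε * ‖f x‖ * x ^ n) := by field_simp
          simp only
          rw [e, e2]
          gcongr
          nlinarith
    _ = ε * (∫ x in Ioc (0 : ℝ) 1, ‖f x‖ ^ 2) + 1 / ε * (1 / (2 * n + 1)) := by
        rw [integral_add (hsq.const_mul ε) (pint.const_mul (1 / ε)), integral_const_mul,
          integral_const_mul, pval]
    _ ≤ ε * (∫ x in Ioc (0 : ℝ) 1, ‖f x‖ ^ 2) + 1 / ε * (1 / n) := by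
        gcongr
        linarith
    _ = _ := by
        rw [← ε_sq]
        field_simp

/-- The moments are `O(n^{-1/2})`, so after division by `n` the terms are `O(n^{-3/2})` and the
Taylor series of the logarithm may be integrated termwise even on `‖z‖ = 1`. -/
theorem hasSum_logTransform (hf : MemLp f 2 (volume.restrict (Ioc (0 : ℝ) 1))) {z : ℂ}
    (hz : ‖z‖ ≤ 1) :
    HasSum (fun n : ℕ => (∫ x in Ioc (0 : ℝ) 1, (x : ℂ) ^ (n + 1) * f x) * (z ^ (n + 1) / (n + 1)))
      (logTransform f z) := by
  have hint : Integrable f (volume.restrict (Ioc (0 : ℝ) 1)) := hf.integrable (by norm_num)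
  have pint : ∀ n : ℕ, Integrable (fun x : ℝ => (x : ℂ) ^ n * f x)
      (volume.restrict (Ioc (0 : ℝ) 1)) := by
    intro n
    refine hint.norm.mono' (Continuous.aestronglyMeasurable (by fun_prop) |>.mul hf.1) ?_
    filter_upwards [ae_restrict_mem measurableSet_Ioc] with x hx
    rw [norm_mul, norm_pow, Complex.norm_real, Real.norm_of_nonneg hx.1.le]
    exact mul_le_of_le_one_left (norm_nonneg _) (pow_le_one₀ hx.1.le hx.2)
  let F : ℕ → ℝ → ℂ := fun n x => (x : ℂ) ^ (n + 1) * f x * (z ^ (n + 1) / (n + 1))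
  have Fint : ∀ n, Integrable (F n) (volume.restrict (Ioc (0 : ℝ) 1)) :=
    fun n => (pint (n + 1)).mul_const _
  have Fsum : Summable fun n => ∫ x in Ioc (0 : ℝ) 1, ‖F n x‖ := by
    set K := (∫ x in Ioc (0 : ℝ) 1, ‖f x‖ ^ 2) + 1
    have base : Summable fun n : ℕ => K * (((n + 1 : ℕ) : ℝ) ^ (-3 / 2 : ℝ)) :=
      ((summable_nat_add_iff 1).mpr (Real.summable_nat_rpow.mpr (by norm_num))).mul_left K
    refine Summable.of_nonneg_of_le (fun n => integral_nonneg fun x => norm_nonneg _)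
      (fun n => ?_) base
    have n_pos : (0 : ℝ) < ((n + 1 : ℕ) : ℝ) := by positivity
    have h1 : ∫ x in Ioc (0 : ℝ) 1, ‖F n x‖
        ≤ ∫ x in Ioc (0 : ℝ) 1, ‖f x‖ * x ^ (n + 1) * (1 / ((n + 1 : ℕ) : ℝ)) := by
      refine integral_mono_ae (Fint n).norm ?_ ?_
      · refine Integrable.mul_const ((pint (n + 1)).norm.congr ?_) _
        filter_upwards [ae_restrict_mem measurableSet_Ioc] with x hx
        rw [norm_mul, norm_pow, Complex.norm_real, Real.norm_of_nonneg hx.1.le, mul_comm]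
      · filter_upwards [ae_restrict_mem measurableSet_Ioc] with x hx
        have hn : ‖(n : ℂ) + 1‖ = ((n + 1 : ℕ) : ℝ) := by
          exact_mod_cast Complex.norm_natCast (n + 1)
        simp only [F]
        rw [norm_mul, norm_mul, norm_pow, Complex.norm_real, Real.norm_of_nonneg hx.1.le,
          norm_div, norm_pow, hn, mul_comm (x ^ (n + 1))]
        have := hx.1.le
        gcongr
        exact pow_le_one₀ (norm_nonneg z) hz
    refine h1.trans ?_
    rw [integral_mul_const]
    calc _ ≤ K * ((n + 1 : ℕ) : ℝ) ^ (-1 / 2 : ℝ) * (1 / ((n + 1 : ℕ) : ℝ)) := by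
          gcongr
          exact integral_norm_mul_pow_le hf (Nat.le_add_left 1 n)
      _ = _ := by
          rw [one_div, ← Real.rpow_neg_one, mul_assoc, ← Real.rpow_add n_pos]
          norm_num
  have key := hasSum_integral_of_summable_integral_norm Fint Fsum
  have e : ∫ x in Ioc (0 : ℝ) 1, ∑' n, F n x = logTransform f z := by
    rw [logTransform, ← integral_neg]
    refine integral_congr_ae ?_
    have ne : ∀ᵐ (x : ℝ) ∂volume.restrict (Ioc (0 : ℝ) 1), x ≠ 1 :=
      ae_restrict_of_ae (Measure.ae_ne volume _)
    filter_upwards [ae_restrict_mem measurableSet_Ioc, ne] with x hx hne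
    have hx1 : x < 1 := lt_of_le_of_ne hx.2 hne
    have hxz : ‖(x : ℂ) * z‖ < 1 := by
      rw [norm_mul, Complex.norm_real, Real.norm_of_nonneg hx.1.le]
      nlinarith [hx.1, norm_nonneg z]
    -- The dropped term is `(xz)^0 / 0`, which is `0` by convention.
    have h1 := (hasSum_nat_add_iff' 1).mpr (Complex.hasSum_taylorSeries_neg_log hxz)
    have h2 := h1.mul_left (f x)
    have e1 : ∀ n, F n x = f x * (((x : ℂ) * z) ^ (n + 1) / ((n + 1 : ℕ) : ℂ)) := by
      intro n
      simp only [F]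
      push_cast
      ring
    simp only [e1]
    rw [h2.tsum_eq]
    simp
  rw [e] at key
  simpa only [F, integral_mul_const] using key

/-! ### The jump across the cut -/

/-- The integral of `f` over `(e^{-v}, 1]`. -/
def cutJump (f : ℝ → ℂ) (v : ℝ) : ℂ :=
  ∫ x in Ioc (0 : ℝ) 1, (Ioi (Real.exp (-v))).indicator f x

lemma norm_cutJump_le (hf : Integrable f (volume.restrict (Ioc (0 : ℝ) 1))) (v : ℝ) :
    ‖cutJump f v‖ ≤ ∫ x in Ioc (0 : ℝ) 1, ‖f x‖ :=
  norm_integral_le_of_norm_le hf.norm (ae_of_all _ fun x => norm_indicator_le_norm_self f x)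

lemma continuous_cutJump (hf : Integrable f (volume.restrict (Ioc (0 : ℝ) 1))) :
    Continuous (cutJump f) := by
  refine continuous_iff_continuousAt.mpr fun v₀ => ?_
  refine continuousAt_of_dominated (bound := fun x => ‖f x‖)
    (Eventually.of_forall fun v => hf.1.indicator measurableSet_Ioi)
    (Eventually.of_forall fun v => ae_of_all _ fun x => norm_indicator_le_norm_self f x)
    hf.norm ?_
  have ne : ∀ᵐ (x : ℝ) ∂volume.restrict (Ioc (0 : ℝ) 1), x ≠ Real.exp (-v₀) :=
    ae_restrict_of_ae (Measure.ae_ne volume _)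
  filter_upwards [ne] with x hx
  have hc : ContinuousAt (fun v : ℝ => Real.exp (-v)) v₀ := by fun_prop
  rcases lt_or_gt_of_ne hx with h | h
  · refine (continuousAt_const (y := (0 : ℂ))).congr ?_
    filter_upwards [hc.eventually_const_lt h] with v hv
    rw [Set.indicator_of_notMem (by simpa using hv.le)]
  · refine (continuousAt_const (y := f x)).congr ?_
    filter_upwards [hc.eventually_lt_const h] with v hv
    rw [Set.indicator_of_mem (by simpa using hv)]

lemma cutJump_zero (f : ℝ → ℂ) : cutJump f 0 = 0 := by
  refine integral_eq_zero_of_ae ?_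
  filter_upwards [ae_restrict_mem measurableSet_Ioc] with x hx
  rw [Set.indicator_of_notMem (by simpa using hx.2)]
  rfl

/-- Integrability of `f` already makes the jump bounded. -/
lemma cutJump_isLittleO (hf : Integrable f (volume.restrict (Ioc (0 : ℝ) 1))) :
    cutJump f =o[atTop] fun v : ℝ => Real.exp (v / 2) := by
  have h1 : cutJump f =O[atTop] fun _ : ℝ => (1 : ℝ) :=
    IsBigO.of_bound (∫ x in Ioc (0 : ℝ) 1, ‖f x‖)
      (Eventually.of_forall fun v => by simpa using norm_cutJump_le hf v)
  refine h1.trans_isLittleO (isLittleO_const_left.mpr (Or.inr ?_))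
  exact tendsto_norm_atTop_atTop.comp
    (Real.tendsto_exp_atTop.comp (tendsto_id.atTop_div_const two_pos))

/-- The continuation of `logTransform f` from the upper half-plane to the cut `(1, ∞)`. -/
def upperLogTransform (f : ℝ → ℂ) (z : ℂ) : ℂ :=
  conj (logTransform (fun x => conj (f x)) (conj z))

lemma upperLogTransform_eq_integral (f : ℝ → ℂ) (z : ℂ) :
    upperLogTransform f z
      = -∫ x in Ioc (0 : ℝ) 1, f x * conj (Complex.log (conj (1 - (x : ℂ) * z))) := by
  rw [upperLogTransform, logTransform, map_neg, ← integral_conj]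
  simp

lemma upperLogTransform_eq (f : ℝ → ℂ) {z : ℂ} (hz : z.im = 0 → z.re ≤ 1) :
    upperLogTransform f z = logTransform f z := by
  rw [upperLogTransform_eq_integral, logTransform]
  congr 1
  refine integral_congr_ae ?_
  have ne : ∀ᵐ (x : ℝ) ∂volume.restrict (Ioc (0 : ℝ) 1), x ≠ 1 :=
    ae_restrict_of_ae (Measure.ae_ne volume _)
  filter_upwards [ae_restrict_mem measurableSet_Ioc, ne] with x hx hne
  have hx1 : x < 1 := lt_of_le_of_ne hx.2 hne
  have slit : 1 - (x : ℂ) * z ∈ slitPlane := by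
    rw [Complex.mem_slitPlane_iff]
    simp
    by_cases h : z.im = 0
    · left
      have := hz h
      nlinarith [hx.1]
    · exact Or.inr ⟨hx.1.ne', h⟩
  rw [Complex.log_conj _ (Complex.mem_slitPlane_iff_arg.mp slit).1, Complex.conj_conj]

lemma continuousOn_upperLogTransform (hf : MemLp f 2 (volume.restrict (Ioc (0 : ℝ) 1))) :
    ContinuousOn (upperLogTransform f) {z | 0 ≤ z.im} := by
  refine continuous_conj.comp_continuousOn
    ((continuousOn_logTransform_lower hf.star).comp continuous_conj.continuousOn ?_)
  intro z hz
  simpa using hz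

/-- On the cut `1 - x e^v` is real, so the two branches differ by `2i arg`, which is `2πi` when `x >
e^{-v}` and `0` otherwise. -/
lemma logTransform_sub_upperLogTransform (hf : MemLp f 2 (volume.restrict (Ioc (0 : ℝ) 1)))
    (v : ℝ) :
    logTransform f (Real.exp v : ℝ) - upperLogTransform f (Real.exp v : ℝ)
      = -(2 * Real.pi * I) * cutJump f v := by
  have h1 := integrable_mul_log hf (Real.exp v : ℝ)
  have h2 : Integrable (fun x : ℝ =>
      f x * conj (Complex.log (conj (1 - (x : ℂ) * (Real.exp v : ℝ)))))
      (volume.restrict (Ioc (0 : ℝ) 1)) := by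
    have := (integrable_mul_log hf.star (Real.exp v : ℝ))
    have h3 := (Complex.conjCLE.toContinuousLinearMap).integrable_comp this
    refine h3.congr (ae_of_all _ fun x => ?_)
    simp [-ofReal_exp]
  rw [upperLogTransform_eq_integral, logTransform, cutJump, ← integral_const_mul,
    neg_sub_neg, ← neg_sub, ← integral_sub h1 h2, ← integral_neg]
  refine integral_congr_ae (ae_of_all _ fun x => ?_)
  have key : ∀ w : ℂ, w.im = 0 → Complex.log w - conj (Complex.log (conj w)) = 2 * w.arg * I := by
    intro w hw
    rw [Complex.conj_eq_iff_im.mpr hw]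
    apply Complex.ext
    · simp
    · simp [Complex.log_im]; ring
  have real : (1 - (x : ℂ) * (Real.exp v : ℝ)) = ((1 - x * Real.exp v : ℝ) : ℂ) := by push_cast; ring
  have hiff : Real.exp (-v) < x ↔ 1 - x * Real.exp v < 0 := by
    rw [Real.exp_neg, sub_neg, inv_lt_iff_one_lt_mul₀ (Real.exp_pos v), mul_comm]
  simp only
  rw [← mul_sub, key _ (by rw [real, Complex.ofReal_im]), real]
  by_cases h : Real.exp (-v) < x
  · rw [Set.indicator_of_mem (by exact h), Complex.arg_ofReal_of_neg (hiff.mp h)]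
    ring
  · rw [Set.indicator_of_notMem (by exact h),
      Complex.arg_ofReal_of_nonneg (not_lt.mp (mt hiff.mpr h))]
    simp

/-! ### Passage to the variable `τ` -/

/-- The sum of the trigonometric series `(1/2π) ∑ aₖ e^{-ikτ}` with `k aₖ` the moments of `f`,
continued to the plane cut along `cutPlus`. -/
def seriesSum (f : ℝ → ℂ) (τ : ℂ) : ℂ := 1 / (2 * Real.pi) * logTransform f (cexp (-I * τ))

lemma seriesSum_add_two_pi (f : ℝ → ℂ) (τ : ℂ) :
    seriesSum f (τ + 2 * Real.pi) = seriesSum f τ := by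
  have : -I * (τ + 2 * Real.pi) = -I * τ - 2 * Real.pi * I := by ring
  rw [seriesSum, seriesSum, this, Complex.exp_periodic.sub_eq]

lemma hasSum_seriesSum (hf : MemLp f 2 (volume.restrict (Ioc (0 : ℝ) 1))) {a : ℕ → ℂ}
    (ha : ∀ k : ℕ, ∫ x in Ioc (0 : ℝ) 1, (x : ℂ) ^ k * f x = k * a k) {τ : ℂ} (hτ : τ.im ≤ 0) :
    HasSum (fun n : ℕ => 1 / (2 * Real.pi) * (a (n + 1) * cexp (-I * (n + 1) * τ)))
      (seriesSum f τ) := by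
  have hz : ‖cexp (-I * τ)‖ ≤ 1 := by
    rw [Complex.norm_exp]
    simpa using hτ
  refine ((hasSum_logTransform hf hz).mul_left (1 / (2 * Real.pi) : ℂ)).congr_fun ?_
  intro n
  have hn : (n : ℂ) + 1 ≠ 0 := by exact_mod_cast Nat.succ_ne_zero n
  rw [ha, ← Complex.exp_nat_mul]
  push_cast
  rw [show ((n : ℂ) + 1) * (-I * τ) = -I * (n + 1) * τ by ring]
  field_simp

lemma exp_neg_I_mul_re (τ : ℂ) : (cexp (-I * τ)).re = Real.exp τ.im * Real.cos τ.re := by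
  rw [Complex.exp_re]; simp

lemma exp_neg_I_mul_im (τ : ℂ) : (cexp (-I * τ)).im = -(Real.exp τ.im * Real.sin τ.re) := by
  rw [Complex.exp_im]; simp

lemma exists_int_of_exp_pos {τ : ℂ} (him : (cexp (-I * τ)).im = 0) (hre : 0 < (cexp (-I * τ)).re) :
    ∃ k : ℤ, τ.re = 2 * k * Real.pi := by
  rw [exp_neg_I_mul_re] at hre
  rw [exp_neg_I_mul_im] at him
  have hsin : Real.sin τ.re = 0 := by
    simpa [(Real.exp_pos _).ne'] using him
  have hcos : 0 < Real.cos τ.re := (mul_pos_iff_of_pos_left (Real.exp_pos _)).mp hre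
  have h1 : Real.cos τ.re = 1 := by
    rcases Real.sin_eq_zero_iff_cos_eq.mp hsin with h | h
    · exact h
    · linarith
  obtain ⟨k, hk⟩ := (Real.cos_eq_one_iff _).mp h1
  exact ⟨k, by rw [← hk]; ring⟩

lemma exp_re_le_one_of_notMem_cutPlus {τ : ℂ} (hτ : τ ∉ cutPlus) :
    (cexp (-I * τ)).im = 0 → (cexp (-I * τ)).re ≤ 1 := by
  intro him
  by_contra! hre
  obtain ⟨k, hk⟩ := exists_int_of_exp_pos him (by linarith)
  refine hτ ⟨k, τ.im, ?_, ?_⟩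
  · rw [exp_neg_I_mul_re] at hre
    have h1 : Real.exp τ.im * Real.cos τ.re ≤ Real.exp τ.im :=
      mul_le_of_le_one_right (Real.exp_pos _).le (Real.cos_le_one _)
    exact Real.one_lt_exp_iff.mp (by linarith)
  · apply Complex.ext <;> simp [hk]

lemma continuousOn_seriesSum (hf : MemLp f 2 (volume.restrict (Ioc (0 : ℝ) 1))) :
    ContinuousOn (seriesSum f) cutPlusᶜ := by
  refine continuousOn_const.mul ((continuousOn_logTransform_of_slit hf).comp
    (by fun_prop) fun τ hτ => ?_)
  exact exp_re_le_one_of_notMem_cutPlus hτ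

lemma mem_slitPlane_of_forall_ne {τ : ℂ} (h : ∀ k : ℤ, τ.re ≠ 2 * k * Real.pi) :
    1 - cexp (-I * τ) ∈ slitPlane := by
  rw [Complex.mem_slitPlane_iff]
  by_contra! hc
  simp only [sub_re, one_re, sub_im, one_im, zero_sub, neg_eq_zero] at hc
  obtain ⟨k, hk⟩ := exists_int_of_exp_pos hc.2 (by linarith)
  exact h k hk

lemma mem_slitPlane_of_notMem_closure {τ : ℂ} (hτ : τ ∉ closure cutPlus) :
    1 - cexp (-I * τ) ∈ slitPlane := by
  rw [Complex.mem_slitPlane_iff]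
  by_contra! hc
  simp only [sub_re, one_re, sub_im, one_im, zero_sub, neg_eq_zero] at hc
  obtain ⟨k, hk⟩ := exists_int_of_exp_pos hc.2 (by linarith)
  have him : 0 ≤ τ.im := by
    have h1 : Real.exp τ.im * Real.cos τ.re ≤ Real.exp τ.im :=
      mul_le_of_le_one_right (Real.exp_pos _).le (Real.cos_le_one _)
    rw [exp_neg_I_mul_re] at hc
    exact Real.one_le_exp_iff.mp (by linarith)
  -- The point may be an end point `2kπ` of a cut; moving it up by `ε` puts it inside.
  refine hτ (mem_closure_of_tendsto (b := 𝓝[>] (0 : ℝ)) (f := fun ε : ℝ => τ + ε * I) ?_ ?_)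
  · have : ContinuousAt (fun ε : ℝ => τ + ε * I) 0 := by fun_prop
    simpa using this.tendsto.mono_left nhdsWithin_le_nhds
  · filter_upwards [self_mem_nhdsWithin] with ε hε
    refine ⟨k, τ.im + ε, add_pos_of_nonneg_of_pos him hε, ?_⟩
    apply Complex.ext <;> simp [hk]

lemma differentiableOn_seriesSum_of_slit (hf : MemLp f 2 (volume.restrict (Ioc (0 : ℝ) 1))) :
    DifferentiableOn ℂ (seriesSum f) {τ | 1 - cexp (-I * τ) ∈ slitPlane} :=
  DifferentiableOn.const_mul ((differentiableOn_logTransform hf).comp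
    (f := fun τ : ℂ => cexp (-I * τ)) (by fun_prop) fun _ hτ => hτ) _

/-- To the right of a cut `e^{-iτ}` lies below the real axis, to the left above it, so the one-sided
limits are the values of `logTransform` and `upperLogTransform` at `e^v`. -/
lemma isJumpPlus_seriesSum (hf : MemLp f 2 (volume.restrict (Ioc (0 : ℝ) 1))) :
    IsJumpPlus (seriesSum f) (cutJump f) := by
  intro k v _
  have arg : ∀ ε : ℝ, cexp (-I * (2 * k * Real.pi + ε + v * I)) = cexp (v - ε * I) := by
    intro ε
    have : -I * (2 * k * Real.pi + ε + v * I) = (v - ε * I) - k * (2 * Real.pi * I) := by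
      linear_combination (-(v : ℂ)) * I_sq
    rw [this, Complex.exp_sub, Complex.exp_int_mul_two_pi_mul_I, div_one]
  have im_eq : ∀ ε : ℝ, (cexp (v - ε * I)).im = -(Real.exp v * Real.sin ε) := by
    intro ε; rw [Complex.exp_im]; simp
  have small : ∀ᶠ ε : ℝ in 𝓝[>] 0, 0 < Real.sin ε := by
    filter_upwards [Ioo_mem_nhdsGT Real.pi_pos] with ε hε
    exact Real.sin_pos_of_pos_of_lt_pi hε.1 hε.2
  have below : Tendsto (fun ε : ℝ => cexp (v - ε * I)) (𝓝[>] 0)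
      (𝓝[{z | z.im ≤ 0}] (Real.exp v : ℝ)) := by
    refine tendsto_nhdsWithin_iff.mpr ⟨?_, ?_⟩
    · have : ContinuousAt (fun ε : ℝ => cexp (v - ε * I)) 0 := by fun_prop
      simpa using this.tendsto.mono_left nhdsWithin_le_nhds
    · filter_upwards [small] with ε hε
      simp only [im_eq]
      have := Real.exp_pos v
      nlinarith
  have above : Tendsto (fun ε : ℝ => cexp (v + ε * I)) (𝓝[>] 0)
      (𝓝[{z | 0 ≤ z.im}] (Real.exp v : ℝ)) := by
    refine tendsto_nhdsWithin_iff.mpr ⟨?_, ?_⟩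
    · have : ContinuousAt (fun ε : ℝ => cexp (v + ε * I)) 0 := by fun_prop
      simpa using this.tendsto.mono_left nhdsWithin_le_nhds
    · filter_upwards [small] with ε hε
      have := im_eq (-ε)
      simp only [ofReal_neg, neg_mul, sub_neg_eq_add, Real.sin_neg] at this
      simp only [this]
      have := Real.exp_pos v
      nlinarith
  have lim1 := ((continuousOn_logTransform_lower hf) (Real.exp v : ℝ) (by simp)).tendsto.comp below
  have lim2 := ((continuousOn_upperLogTransform hf) (Real.exp v : ℝ) (by simp)).tendsto.comp above
  have lim := (lim1.sub lim2).const_mul (I * (1 / (2 * Real.pi)))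
  rw [logTransform_sub_upperLogTransform hf] at lim
  have value : I * (1 / (2 * Real.pi)) * (-(2 * Real.pi * I) * cutJump f v) = cutJump f v := by
    have : (Real.pi : ℂ) ≠ 0 := by exact_mod_cast Real.pi_ne_zero
    field_simp
    linear_combination (-cutJump f v) * I_sq
  rw [value] at lim
  refine lim.congr' ?_
  filter_upwards [small] with ε hε
  have h1 := arg (-ε)
  have h2 := im_eq (-ε)
  simp only [ofReal_neg, neg_mul, sub_neg_eq_add, Real.sin_neg, ← sub_eq_add_neg] at h1 h2
  have h3 : upperLogTransform f (cexp (v + ε * I)) = logTransform f (cexp (v + ε * I)) := by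
    refine upperLogTransform_eq f fun h => ?_
    rw [h2] at h
    have := mul_pos (Real.exp_pos v) hε
    linarith
  have h4 := arg ε
  simp only [neg_mul] at h4
  simp only [Function.comp_apply, seriesSum, neg_mul, h4, h1, h3]
  ring

/-- The left half of the strip maps into the closed lower half-plane and the right half into the
upper one. On the middle line `e^{-iτ}` is negative, where the two branches agree, so they glue. -/
lemma exists_continuousOn_closedStrip (hf : MemLp f 2 (volume.restrict (Ioc (0 : ℝ) 1))) (k : ℤ) :
    ∃ F : ℂ → ℂ, ContinuousOn F (closedStrip k) ∧
      EqOn F (seriesSum f) (closedStrip k \ cutPlus) := by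
  have sin_shift : ∀ t : ℝ, Real.sin t = Real.sin (t - 2 * k * Real.pi) := by
    intro t
    rw [show t - 2 * k * Real.pi = t - k * (2 * Real.pi) by ring, Real.sin_sub_int_mul_two_pi]
  have sin_shift' : ∀ t : ℝ, Real.sin t = -Real.sin (t - (2 * k + 1) * Real.pi) := by
    intro t
    rw [sin_shift, show t - (2 * k + 1) * Real.pi = t - 2 * k * Real.pi - Real.pi by ring,
      Real.sin_sub_pi, neg_neg]
  let F : ℂ → ℂ := fun τ => 1 / (2 * Real.pi) * (if τ.re ≤ (2 * k + 1) * Real.pi then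
    logTransform f (cexp (-I * τ)) else upperLogTransform f (cexp (-I * τ)))
  have cover : closedStrip k = {τ : ℂ | 2 * k * Real.pi ≤ τ.re ∧ τ.re ≤ (2 * k + 1) * Real.pi} ∪
      {τ : ℂ | (2 * k + 1) * Real.pi ≤ τ.re ∧ τ.re ≤ 2 * (k + 1) * Real.pi} := by
    ext τ
    have := Real.pi_pos
    simp only [closedStrip, mem_ofPred_eq, mem_union]
    constructor
    · rintro ⟨h1, h2⟩
      rcases le_total τ.re ((2 * k + 1) * Real.pi) with h | h
      · exact Or.inl ⟨h1, h⟩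
      · exact Or.inr ⟨h, h2⟩
    · rintro (⟨h1, h2⟩ | ⟨h1, h2⟩)
      · exact ⟨h1, by nlinarith⟩
      · exact ⟨by nlinarith, h2⟩
  have upper_eq : ∀ τ : ℂ, τ.re = (2 * k + 1) * Real.pi →
      upperLogTransform f (cexp (-I * τ)) = logTransform f (cexp (-I * τ)) := by
    intro τ hτ
    refine upperLogTransform_eq f fun _ => ?_
    rw [exp_neg_I_mul_re, hτ, show (2 * (k : ℝ) + 1) * Real.pi = k * (2 * Real.pi) + Real.pi by ring,
      Real.cos_int_mul_two_pi_add_pi]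
    have := Real.exp_pos τ.im
    linarith
  refine ⟨F, ?_, ?_⟩
  · rw [cover]
    refine ContinuousOn.union_of_isClosed ?_ ?_ ?_ ?_
    · have : ContinuousOn (fun τ => 1 / (2 * Real.pi) * logTransform f (cexp (-I * τ)))
          {τ : ℂ | 2 * k * Real.pi ≤ τ.re ∧ τ.re ≤ (2 * k + 1) * Real.pi} := by
        refine continuousOn_const.mul ((continuousOn_logTransform_lower hf).comp (by fun_prop) ?_)
        rintro τ ⟨h1, h2⟩
        have h3 : 0 ≤ Real.sin τ.re := by
          rw [sin_shift]
          exact Real.sin_nonneg_of_nonneg_of_le_pi (by linarith) (by linarith)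
        simp only [mem_ofPred_eq, exp_neg_I_mul_im]
        have := mul_nonneg (Real.exp_pos τ.im).le h3
        linarith
      refine this.congr fun τ hτ => ?_
      simp only [F, if_pos hτ.2]
    · have : ContinuousOn (fun τ => 1 / (2 * Real.pi) * upperLogTransform f (cexp (-I * τ)))
          {τ : ℂ | (2 * k + 1) * Real.pi ≤ τ.re ∧ τ.re ≤ 2 * (k + 1) * Real.pi} := by
        refine continuousOn_const.mul ((continuousOn_upperLogTransform hf).comp (by fun_prop) ?_)
        rintro τ ⟨h1, h2⟩
        have h3 : Real.sin τ.re ≤ 0 := by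
          rw [sin_shift', neg_nonpos]
          exact Real.sin_nonneg_of_nonneg_of_le_pi (by linarith) (by linarith)
        simp only [mem_ofPred_eq, exp_neg_I_mul_im]
        have := mul_nonneg (Real.exp_pos τ.im).le (neg_nonneg.mpr h3)
        linarith
      refine this.congr fun τ hτ => ?_
      simp only [F]
      split_ifs with h
      · rw [upper_eq τ (le_antisymm h hτ.1)]
      · rfl
    · exact (isClosed_le continuous_const continuous_re).inter
        (isClosed_le continuous_re continuous_const)
    · exact (isClosed_le continuous_const continuous_re).inter
        (isClosed_le continuous_re continuous_const)
  · rintro τ ⟨-, hτ⟩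
    simp only [F, seriesSum]
    split_ifs with h
    · rfl
    · rw [upperLogTransform_eq f (exp_re_le_one_of_notMem_cutPlus hτ)]

/-! ### Laplace transforms -/

lemma integrableOn_cutJump_mul_exp (hf : Integrable f (volume.restrict (Ioc (0 : ℝ) 1))) {s : ℂ}
    (hs : 0 < s.re) : IntegrableOn (fun v : ℝ => cutJump f v * cexp (-s * v)) (Ioi 0) :=
  (integrableOn_exp_mul_complex_Ioi (a := -s) (by simpa) 0).bdd_mul
    (continuous_cutJump hf).aestronglyMeasurable (ae_of_all _ fun v => norm_cutJump_le hf v)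

/-- Fubini: for fixed `x` the variable `v` runs over `(-log x, ∞)`, and the inner integral is `x^s /
s`. -/
lemma laplacePlus_cutJump (hf : Integrable f (volume.restrict (Ioc (0 : ℝ) 1))) {s : ℂ}
    (hs : 0 < s.re) :
    laplacePlus (cutJump f) s = (∫ x in Ioc (0 : ℝ) 1, cexp (s * Real.log x) * f x) / s := by
  have hs0 : s ≠ 0 := by rintro rfl; simp at hs
  have eint := integrableOn_exp_mul_complex_Ioi (a := -s) (by simpa) 0
  have joint : Integrable (Function.uncurry fun v x : ℝ =>
      (Ioi (Real.exp (-v))).indicator f x * cexp (-s * v))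
      ((volume.restrict (Ioi (0 : ℝ))).prod (volume.restrict (Ioc (0 : ℝ) 1))) := by
    have prod := (eint.integrable.mul_prod hf)
    have hmeas : MeasurableSet {p : ℝ × ℝ | Real.exp (-p.1) < p.2} :=
      measurableSet_lt (by fun_prop) (by fun_prop)
    refine (prod.indicator hmeas).congr (ae_of_all _ fun p => ?_)
    by_cases h : Real.exp (-p.1) < p.2
    · rw [Set.indicator_of_mem (by exact h), Function.uncurry, Set.indicator_of_mem (by exact h),
        mul_comm]
    · rw [Set.indicator_of_notMem (by exact h), Function.uncurry,
        Set.indicator_of_notMem (by exact h), zero_mul]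
  calc laplacePlus (cutJump f) s
      = ∫ v in Ioi (0 : ℝ), ∫ x in Ioc (0 : ℝ) 1,
          (Ioi (Real.exp (-v))).indicator f x * cexp (-s * v) := by
        simp only [laplacePlus, cutJump, integral_mul_const]
    _ = ∫ x in Ioc (0 : ℝ) 1, ∫ v in Ioi (0 : ℝ),
          (Ioi (Real.exp (-v))).indicator f x * cexp (-s * v) := integral_integral_swap joint
    _ = ∫ x in Ioc (0 : ℝ) 1, cexp (s * Real.log x) * f x / s := by
        refine integral_congr_ae ?_
        filter_upwards [ae_restrict_mem measurableSet_Ioc] with x hx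
        have hlog : Real.log x ≤ 0 := Real.log_nonpos hx.1.le hx.2
        have e : ∀ v : ℝ, (Ioi (Real.exp (-v))).indicator f x * cexp (-s * v)
            = (Ioi (-Real.log x)).indicator (fun v : ℝ => f x * cexp (-s * v)) v := by
          intro v
          have : x ∈ Ioi (Real.exp (-v)) ↔ v ∈ Ioi (-Real.log x) := by
            rw [mem_Ioi, mem_Ioi, ← Real.lt_log_iff_exp_lt hx.1, neg_lt]
          by_cases h : v ∈ Ioi (-Real.log x)
          · rw [Set.indicator_of_mem (this.mpr h), Set.indicator_of_mem h]
          · rw [Set.indicator_of_notMem (mt this.mp h), Set.indicator_of_notMem h, zero_mul]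
        simp only [e]
        rw [setIntegral_indicator measurableSet_Ioi,
          inter_eq_self_of_subset_right (Ioi_subset_Ioi (by linarith)), integral_const_mul,
          integral_exp_mul_complex_Ioi (by simpa)]
        push_cast
        rw [neg_mul_neg]
        field_simp
    _ = _ := integral_div _ _

lemma laplacePlus_cutJump_natCast (hf : Integrable f (volume.restrict (Ioc (0 : ℝ) 1)))
    {a : ℕ → ℂ} (ha : ∀ k : ℕ, ∫ x in Ioc (0 : ℝ) 1, (x : ℂ) ^ k * f x = k * a k) {k : ℕ}
    (hk : 1 ≤ k) : laplacePlus (cutJump f) k = a k := by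
  have hk0 : (k : ℂ) ≠ 0 := by exact_mod_cast (by omega : k ≠ 0)
  rw [laplacePlus_cutJump hf (by simpa using Nat.lt_of_lt_of_le zero_lt_one hk), div_eq_iff hk0, mul_comm (a k), ← ha k]
  refine integral_congr_ae ?_
  filter_upwards [ae_restrict_mem measurableSet_Ioc] with x hx
  rw [Complex.exp_nat_mul, ← Complex.ofReal_exp, Real.exp_log hx.1]

lemma analyticOnNhd_laplacePlus_cutJump (hf : Integrable f (volume.restrict (Ioc (0 : ℝ) 1))) :
    AnalyticOnNhd ℂ (laplacePlus (cutJump f)) {s : ℂ | 1 / 2 < s.re} := by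
  have hopen : IsOpen {s : ℂ | 1 / 2 < s.re} := isOpen_lt continuous_const continuous_re
  refine DifferentiableOn.analyticOnNhd (fun s₀ hs₀ => ?_) hopen
  have hs₀' : 1 / 2 < s₀.re := hs₀
  set C := ∫ x in Ioc (0 : ℝ) 1, ‖f x‖
  have key := hasDerivAt_integral_of_dominated_loc_of_deriv_le
    (μ := volume.restrict (Ioi (0 : ℝ))) (s := {s : ℂ | 1 / 2 < s.re}) (x₀ := s₀)
    (F := fun s v => cutJump f v * cexp (-s * v))
    (F' := fun s v => cutJump f v * (cexp (-s * v) * -(v : ℂ)))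
    -- Half of the decay `e^{-v/2}` absorbs the factor `v`, since `v ≤ 4 e^{v/4}`.
    (bound := fun v => C * (4 * Real.exp (-(1 / 4) * v)))
    (hopen.mem_nhds hs₀)
    (Eventually.of_forall fun s => ((continuous_cutJump hf).mul (by fun_prop)).aestronglyMeasurable)
    (integrableOn_cutJump_mul_exp hf (by linarith))
    ((continuous_cutJump hf).mul (by fun_prop)).aestronglyMeasurable ?_
    (((integrableOn_exp_mul_Ioi (by norm_num) 0).const_mul 4).const_mul C) ?_
  · exact key.2.differentiableAt.differentiableWithinAt
  · filter_upwards [ae_restrict_mem measurableSet_Ioi] with v hv s hs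
    have hv' : 0 < v := hv
    have hs' : 1 / 2 < s.re := hs
    rw [norm_mul, norm_mul, norm_neg, Complex.norm_real, Real.norm_of_nonneg hv'.le,
      Complex.norm_exp]
    refine mul_le_mul (norm_cutJump_le hf v) ?_ (by positivity)
      (integral_nonneg fun x => norm_nonneg _)
    have h1 : (-s * (v : ℂ)).re ≤ -(1 / 4) * v + -(1 / 4) * v := by
      simp
      nlinarith
    have h2 : v ≤ 4 * Real.exp (1 / 4 * v) := by
      linarith [Real.add_one_le_exp (1 / 4 * v)]
    calc Real.exp (-s * (v : ℂ)).re * v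
        ≤ Real.exp (-(1 / 4) * v + -(1 / 4) * v) * (4 * Real.exp (1 / 4 * v)) := by gcongr
      _ = 4 * (Real.exp (-(1 / 4) * v) * (Real.exp (-(1 / 4) * v) * Real.exp (1 / 4 * v))) := by
          rw [Real.exp_add]; ring
      _ = 4 * Real.exp (-(1 / 4) * v) := by
          rw [← Real.exp_add (-(1 / 4) * v) (1 / 4 * v)]; simp
  · refine ae_of_all _ fun v s _ => ?_
    have h1 : HasDerivAt (fun s : ℂ => -s * (v : ℂ)) (-(v : ℂ)) s := by
      simpa using ((hasDerivAt_id s).neg.mul_const (v : ℂ))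
    exact h1.cexp.const_mul _

/-! ### The reflection `τ ↦ -τ` -/

lemma laplaceMinus_comp_neg (J : ℝ → ℂ) : laplaceMinus (fun v => J (-v)) = laplacePlus J := by
  funext s
  have := integral_comp_neg_Iic 0 fun v : ℝ => J v * cexp (-s * v)
  rw [neg_zero, integral_Iic_eq_integral_Iio] at this
  rw [laplaceMinus, laplacePlus, ← this]
  simp

lemma neg_mem_cutPlus {τ : ℂ} : -τ ∈ cutPlus ↔ τ ∈ cutMinus := by
  constructor
  · rintro ⟨k, v, hv, h⟩
    exact ⟨-k, v, hv, by push_cast; linear_combination -h⟩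
  · rintro ⟨k, v, hv, rfl⟩
    exact ⟨-k, v, hv, by push_cast; ring⟩

lemma neg_mem_closure_cutPlus {τ : ℂ} : -τ ∈ closure cutPlus ↔ τ ∈ closure cutMinus := by
  have : cutMinus = (Homeomorph.neg ℂ) ⁻¹' cutPlus := by
    ext τ
    exact neg_mem_cutPlus.symm
  rw [this, ← (Homeomorph.neg ℂ).preimage_closure]
  rfl

lemma neg_mem_closedStrip {τ : ℂ} {k : ℤ} (h : τ ∈ closedStrip k) : -τ ∈ closedStrip (-k - 1) := by
  simp only [closedStrip, mem_ofPred_eq, neg_re] at h ⊢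
  push_cast
  constructor <;> linarith [h.1, h.2]

lemma ne_of_mem_openStrip {τ : ℂ} {k : ℤ} (h : τ ∈ openStrip k) (n : ℤ) :
    τ.re ≠ 2 * n * Real.pi := by
  intro hn
  simp only [openStrip, mem_ofPred_eq, hn] at h
  have h1 : (k : ℝ) < n := by nlinarith [Real.pi_pos]
  have h2 : (n : ℝ) < k + 1 := by nlinarith [Real.pi_pos]
  norm_cast at h1 h2
  omega

end KMSBoson

end

/-! ### Assembly of the theorem -/

theorem mainTheorem2 (g : ℤ → ℂ)
    (hplus : KMSBoson.HausdorffCondition 2 (fun k : ℕ => (k : ℂ) * g k))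
    (hminus : KMSBoson.HausdorffCondition 2 (fun k : ℕ => (k : ℂ) * g (-k))) :
    ∃ (Gp Gm : ℂ → ℂ) (Jp Jm : ℝ → ℂ),
      -- `Gp`, `Gm` are given by the two trigonometric series where these converge
      KMSBoson.SumsPlus g Gp ∧ KMSBoson.SumsMinus g Gm ∧
      -- (i) continuity on the real axis
      Continuous (fun u : ℝ => Gp u) ∧ Continuous (fun u : ℝ => Gm u) ∧
      -- (ii) holomorphy off the cuts, continuity up to the branch points `2kπ`
      DifferentiableOn ℂ Gp (closure KMSBoson.cutPlus)ᶜ ∧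
      ContinuousOn Gp KMSBoson.cutPlusᶜ ∧
      DifferentiableOn ℂ Gm (closure KMSBoson.cutMinus)ᶜ ∧
      ContinuousOn Gm KMSBoson.cutMinusᶜ ∧
      -- (iii) the jump functions
      KMSBoson.IsJumpPlus Gp Jp ∧ ContinuousOn Jp (Ici 0) ∧
      Jp =o[atTop] (fun v : ℝ => Real.exp (v / 2)) ∧ Jp 0 = 0 ∧
      KMSBoson.IsJumpMinus Gm Jm ∧ ContinuousOn Jm (Iic 0) ∧
      Jm =o[atBot] (fun v : ℝ => Real.exp (-v / 2)) ∧ Jm 0 = 0 ∧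
      -- (iv) the KMS structure of `Gp + Gm + g 0 / 2π`
      (∀ τ : ℂ, τ ∉ KMSBoson.cutPlus ∪ KMSBoson.cutMinus →
        Gp (τ + 2 * Real.pi) + Gm (τ + 2 * Real.pi) + g 0 / (2 * Real.pi)
          = Gp τ + Gm τ + g 0 / (2 * Real.pi)) ∧
      (∀ k : ℤ,
        DifferentiableOn ℂ (fun τ => Gp τ + Gm τ + g 0 / (2 * Real.pi)) (KMSBoson.openStrip k) ∧
        ∃ F : ℂ → ℂ, ContinuousOn F (KMSBoson.closedStrip k) ∧
          EqOn F (fun τ => Gp τ + Gm τ + g 0 / (2 * Real.pi))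
            (KMSBoson.closedStrip k \ (KMSBoson.cutPlus ∪ KMSBoson.cutMinus))) ∧
      -- (v) the Laplace transforms converge absolutely and are analytic in `Re s > 1/2`
      (∀ s : ℂ, 1 / 2 < s.re →
        IntegrableOn (fun v : ℝ => Jp v * cexp (-s * v)) (Ioi 0) ∧
        IntegrableOn (fun v : ℝ => Jm v * cexp (s * v)) (Iio 0)) ∧
      AnalyticOnNhd ℂ (KMSBoson.laplacePlus Jp) {s : ℂ | 1 / 2 < s.re} ∧
      AnalyticOnNhd ℂ (KMSBoson.laplaceMinus Jm) {s : ℂ | 1 / 2 < s.re} ∧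
      -- (vi) interpolation of the Fourier coefficients
      (∀ k : ℕ, 1 ≤ k → KMSBoson.laplacePlus Jp k = g k ∧ KMSBoson.laplaceMinus Jm k = g (-k)) := by
  obtain ⟨f, hf, hfm⟩ := KMSBoson.exists_density_of_hausdorffCondition hplus
  obtain ⟨h, hh, hhm⟩ := KMSBoson.exists_density_of_hausdorffCondition hminus
  have fint : Integrable f (volume.restrict (Ioc (0 : ℝ) 1)) := hf.integrable (by norm_num)
  have hint : Integrable h (volume.restrict (Ioc (0 : ℝ) 1)) := hh.integrable (by norm_num)
  have contMinus : ContinuousOn (fun τ => KMSBoson.seriesSum h (-τ)) KMSBoson.cutMinusᶜ :=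
    (KMSBoson.continuousOn_seriesSum hh).comp continuous_neg.continuousOn
      fun τ hτ => mt KMSBoson.neg_mem_cutPlus.mp hτ
  refine ⟨KMSBoson.seriesSum f, fun τ => KMSBoson.seriesSum h (-τ), KMSBoson.cutJump f,
    fun v => KMSBoson.cutJump h (-v), ?_, ?_, ?_, ?_, ?_, KMSBoson.continuousOn_seriesSum hf, ?_,
    contMinus, KMSBoson.isJumpPlus_seriesSum hf,
    (KMSBoson.continuous_cutJump fint).continuousOn, KMSBoson.cutJump_isLittleO fint,
    KMSBoson.cutJump_zero f, ?_, ((KMSBoson.continuous_cutJump hint).comp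
    continuous_neg).continuousOn, (KMSBoson.cutJump_isLittleO hint).comp_tendsto
    tendsto_neg_atBot_atTop, by simpa using KMSBoson.cutJump_zero h, ?_, fun k => ⟨?_, ?_⟩, ?_,
    KMSBoson.analyticOnNhd_laplacePlus_cutJump fint, ?_, ?_⟩
  · intro τ hτ
    simpa using KMSBoson.hasSum_seriesSum (a := fun k => g k) hf hfm hτ
  · intro τ hτ
    simpa using KMSBoson.hasSum_seriesSum (a := fun k => g (-k)) hh hhm (τ := -τ) (by simpa using hτ)
  · refine (KMSBoson.continuousOn_seriesSum hf).comp_continuous continuous_ofReal ?_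
    rintro u ⟨k, v, hv, huv⟩
    have := congrArg Complex.im huv
    simp at this
    exact hv.ne this
  · refine contMinus.comp_continuous continuous_ofReal ?_
    rintro u ⟨k, v, hv, huv⟩
    have := congrArg Complex.im huv
    simp at this
    exact hv.ne' this
  · exact (KMSBoson.differentiableOn_seriesSum_of_slit hf).mono
      fun τ hτ => KMSBoson.mem_slitPlane_of_notMem_closure hτ
  · exact (KMSBoson.differentiableOn_seriesSum_of_slit hh).comp differentiable_neg.differentiableOn
      fun τ hτ => KMSBoson.mem_slitPlane_of_notMem_closure
        (mt KMSBoson.neg_mem_closure_cutPlus.mp hτ)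
  · intro k v hv
    -- Reflection exchanges the two sides of the cut; the sign in `-I` compensates.
    refine (KMSBoson.isJumpPlus_seriesSum hh (-k) (-v) (neg_nonneg.mpr hv)).congr fun ε => ?_
    have e1 : -(2 * k * Real.pi - ε + v * I) = 2 * (-k : ℤ) * Real.pi + ε + (-v : ℝ) * I := by
      push_cast; ring
    have e2 : -(2 * k * Real.pi + ε + v * I) = 2 * (-k : ℤ) * Real.pi - ε + (-v : ℝ) * I := by
      push_cast; ring
    simp only [e1, e2]
    ring
  · intro τ _
    have := KMSBoson.seriesSum_add_two_pi h (-(τ + 2 * Real.pi))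
    rw [neg_add, neg_add_cancel_right] at this
    rw [KMSBoson.seriesSum_add_two_pi]
    simp only [neg_add, this]
  · refine DifferentiableOn.add_const _ (DifferentiableOn.add ?_ ?_)
    · exact (KMSBoson.differentiableOn_seriesSum_of_slit hf).mono
        fun τ hτ => KMSBoson.mem_slitPlane_of_forall_ne (KMSBoson.ne_of_mem_openStrip hτ)
    · refine (KMSBoson.differentiableOn_seriesSum_of_slit hh).comp
        differentiable_neg.differentiableOn
        fun τ hτ => KMSBoson.mem_slitPlane_of_forall_ne fun n hn => ?_
      refine KMSBoson.ne_of_mem_openStrip hτ (-n) ?_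
      rw [neg_re] at hn
      push_cast
      linarith
  · obtain ⟨F₁, hF₁, hE₁⟩ := KMSBoson.exists_continuousOn_closedStrip hf k
    obtain ⟨F₂, hF₂, hE₂⟩ := KMSBoson.exists_continuousOn_closedStrip hh (-k - 1)
    refine ⟨fun τ => F₁ τ + F₂ (-τ) + g 0 / (2 * Real.pi), ?_, ?_⟩
    · exact (hF₁.add (hF₂.comp continuous_neg.continuousOn
        fun τ hτ => KMSBoson.neg_mem_closedStrip hτ)).add continuousOn_const
    · rintro τ ⟨hτ, hcut⟩
      rw [mem_union, not_or] at hcut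
      have e1 := hE₁ ⟨hτ, hcut.1⟩
      have e2 := hE₂ ⟨KMSBoson.neg_mem_closedStrip hτ, mt KMSBoson.neg_mem_cutPlus.mp hcut.2⟩
      simp only [e1, e2]
  · intro s hs
    refine ⟨KMSBoson.integrableOn_cutJump_mul_exp fint (by linarith), ?_⟩
    have := (KMSBoson.integrableOn_cutJump_mul_exp hint (s := s) (by linarith)).comp_neg
    simpa using this
  · rw [KMSBoson.laplaceMinus_comp_neg]
    exact KMSBoson.analyticOnNhd_laplacePlus_cutJump hint
  · intro k hk
    rw [KMSBoson.laplaceMinus_comp_neg]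
    exact ⟨KMSBoson.laplacePlus_cutJump_natCast (a := fun k => g k) fint hfm hk,
      KMSBoson.laplacePlus_cutJump_natCast (a := fun k => g (-k)) hint hhm hk⟩
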